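/- **Theorem 1.5.** Let $p$ be a prime and let $n,r\ge 1$ be integers with $p\nmid n$. Let $L$ be an algebraically closed field of characteristic $p$, let $\zeta_n\in L$ be a primitive $n$-th root of unity, let $V\subset L$ be an $\mathbb F_p(\zeta_n^2)$-subspace with $\dim_{\mathbb F_p}V=r$ (so that $[\mathbb F_p(\zeta_n^2):\mathbb F_p]$ divides $r$), let $\alpha_1,\dots,\alpha_r$ be an $\mathbb F_p$-basis of $V$, and let $a\in L$, where $a=0$ if $n\le 2$. Let $G(n,p^r)$ be the subgroup of $SL_2(L)$ generated by $$\sigma_i=\begin{pmatrix}1&\alpha_i\\0&1\end{pmatrix}\ (1\le i\le r),\qquad \tau=\begin{pmatrix}\zeta_n&a\\0&\zeta_n^{-1}\end{pmatrix}.$$ For a field $K$, a finite group $G$ and a faithful finite-dimensional representation $W$ of $G$ over $K$, let $G$ act on the field $K(W)$ of rational functions on $W$, and put $$\operatorname{ed}_K(G)=\min\{\operatorname{trdeg}_K E\},$$ where $E$ runs over the fields $K\subseteq E\subseteq K(W)$ that are stable under $G$ and on which $G$ acts faithfully. Let $K$ be any field of characteristic $p$ and let $G=G(n,p^r)$. Then,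 whichever faithful finite-dimensional representation $W$ of $G$ over $K$ is used to compute $\operatorname{ed}_K(G)$, $$\operatorname{ed}_K(G)=1\iff n\text{ is odd, } K\text{ contains a primitive } n\text{-th root of unity, and } [K:\mathbb F_p]\ge r,$$ where $[K:\mathbb F_p]$ may be infinite. -/

import Mathlib

open scoped MatrixGroups IntermediateField

namespace EssDim

noncomputable section

section FunctionField

variable {K : Type*} [Field K] {G : Type*} [Group G] {V : Type*} [AddCommGroup V] [Module K V]

variable (K V) in
/-- The ring `K[V]` of polynomial functions on `V`: the symmetric algebra of the dual space. -/
abbrev CoordRing : Type _ := SymmetricAlgebra K (Module.Dual K V)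

variable (K V) in
/-- The field `K(V)` of rational functions on `V`. -/
abbrev FunField : Type _ := FractionRing (CoordRing K V)

/-- The endomorphism of `K[V]` induced by `g : G`: the algebra map that on linear forms is
`ℓ ↦ ℓ ∘ ρ g⁻¹`. -/
def coordHom (ρ : Representation K G V) (g : G) : CoordRing K V →ₐ[K] CoordRing K V :=
  SymmetricAlgebra.lift (SymmetricAlgebra.ι K (Module.Dual K V) ∘ₗ ρ.dual g)

theorem coordHom_one (ρ : Representation K G V) : coordHom ρ 1 = AlgHom.id K _ := by
  apply SymmetricAlgebra.algHom_ext
  ext x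
  simp only [coordHom, map_one ρ.dual]
  simp

theorem coordHom_mul (ρ : Representation K G V) (g h : G) :
    coordHom ρ (g * h) = (coordHom ρ g).comp (coordHom ρ h) := by
  apply SymmetricAlgebra.algHom_ext
  ext x
  simp only [coordHom, map_mul ρ.dual]
  simp

/-- The action of `G` on `K[V]` by `K`-algebra automorphisms. -/
def coordAction (ρ : Representation K G V) : G →* (CoordRing K V ≃ₐ[K] CoordRing K V) where
  toFun g := AlgEquiv.ofAlgHom (coordHom ρ g) (coordHom ρ g⁻¹)
    (by rw [← coordHom_mul, mul_inv_cancel, coordHom_one])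
    (by rw [← coordHom_mul, inv_mul_cancel, coordHom_one])
  map_one' := by
    ext x
    simp [coordHom_one]
  map_mul' g h := by
    ext x
    simp [coordHom_mul]

/-- The action of `G` on `K(V)` by `K`-automorphisms, extending the action on `K[V]`. -/
def funAction (ρ : Representation K G V) : G →* (FunField K V ≃ₐ[K] FunField K V) :=
  (IsFractionRing.fieldEquivOfAlgEquivHom K (FunField K V)).comp (coordAction ρ)

/-- `E` is a faithful `G`-subfield of `K(V)`: an intermediate field `K ⊆ E ⊆ K(V)` that is stable
under `G` and on which only the identity of `G` acts trivially. -/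
structure IsFaithfulSubfield (ρ : Representation K G V)
    (E : IntermediateField K (FunField K V)) : Prop where
  stable : ∀ g : G, ∀ x ∈ E, funAction ρ g x ∈ E
  faithful : ∀ g : G, (∀ x ∈ E, funAction ρ g x = x) → g = 1

/-- The essential dimension of `G` over `K`, computed with the (faithful, finite-dimensional)
representation `ρ` of `G` on the `K`-vector space `V`: the minimum of `trdeg_K E` over the faithful
`G`-subfields `E` of `K(V)`. -/
def essDim (ρ : Representation K G V) : Cardinal :=
  sInf {d : Cardinal | ∃ E : IntermediateField K (FunField K V),
    IsFaithfulSubfield ρ E ∧ d = Algebra.trdeg K E}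

end FunctionField

section TheGroup

variable {L : Type*} [Field L]

/-- The matrix `(1, v; 0, 1)` in `SL₂(L)`. -/
def sigma (v : L) : SL(2, L) := ⟨!![1, v; 0, 1], by simp⟩

/-- The matrix `(z, a; 0, z⁻¹)` in `SL₂(L)`. -/
def tau (z : Lˣ) (a : L) : SL(2, L) := ⟨!![(z : L), a; 0, ((z⁻¹ : Lˣ) : L)], by simp⟩

/-- The subgroup of `SL₂(L)` generated by the matrices `(1, α i; 0, 1)` and `(z, a; 0, z⁻¹)`.
It is the group `G(n, p ^ r)` when `L` is an algebraically closed field of characteristic `p`,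
`z = ζ` is a primitive `n`-th root of unity, `α` is an `𝔽_p`-basis of an `r`-dimensional
`𝔽_p(ζ²)`-subspace of `L`, and `a = 0` if `n ≤ 2`. -/
def semidirectGroup {r : ℕ} (z : Lˣ) (a : L) (α : Fin r → L) : Subgroup SL(2, L) :=
  Subgroup.closure (Set.range (fun i => sigma (α i)) ∪ {tau z a})

end TheGroup

end

end EssDim

namespace EssDim

/-! ### Specializing rational function fields in several variables to one variable -/

section Specialization

open Polynomial

/-! Let `E` be a faithful subfield of transcendence degree one. A well-chosen specialization of the
polynomial ring of `W` to one variable embeds `E` in `K(X)` (`exists_algHom_ratFunc`), also over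
finite `K`. By Lüroth `E ≅ K(X)`, whose automorphisms are Möbius transformations
(`exists_isMoebiusImage`), so `G` embeds in `PGL₂(K)`.

There, a lift of a nontrivial translation has scalar `p`-th power `c`. If `c` is a `p`-th power in
`K`, the lift is, up to conjugation and scalars, a transvection (`of_unipotent`). Then `V` becomes a
group of upper unitriangular matrices, hence embeds additively in `K`, which bounds `r`. The element
`τ` becomes triangular, and the ratio of its diagonal entries is a primitive `n`-th root of unity.
If `n = 2m`, then `τ ^ m` centralizes `V`, so that ratio already has `m`-th power one, a
contradiction. If `c` is not a `p`-th power, determinants force `p = 2`; then `τ² = 1`, so `n = 1`,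
and `K`, being imperfect, is infinite (`sq_eq_one_of_not_isSquare`).

Conversely, `G` acts on the line over `L` by `x ↦ g₀₀² x + g₀₀ g₀₁`, preserving `f + V` where `f` is
fixed by `τ`. For odd `n` this action is faithful. Embeddings of `𝔽_p(ζ²)` and of `V` in `K` turn it
into an affine action over `K` (`exists_affine`), which averaging realizes on a function generating
`E` (`exists_isFaithfulSubfield_of_affine`). Degree zero never occurs, because elements of `K(W)`
algebraic over `K` are constants. -/

theorem exists_weight_injOn {m : ℕ} (S : Finset (Fin m →₀ ℕ)) :
    ∃ w : Fin m → ℕ, Set.InjOn (fun s : Fin m →₀ ℕ => ∑ i, s i * w i) S := by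
  obtain ⟨N, hN1, hN⟩ : ∃ N, 1 < N ∧ ∀ s ∈ S, ∀ i, s i < N := by
    -- The `+ 2` makes the base exceed every exponent and also exceed one when all exponents vanish;
    -- the weighted sums are then base-`N` expansions.
    refine ⟨(S.sup fun s => Finset.univ.sup s) + 2, by omega, fun s hs i => ?_⟩
    have h1 : s i ≤ Finset.univ.sup s := Finset.le_sup (f := s) (Finset.mem_univ i)
    have h2 : Finset.univ.sup s ≤ S.sup fun s => Finset.univ.sup s :=
      Finset.le_sup (f := fun s : Fin m →₀ ℕ => Finset.univ.sup s) hs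
    omega
  refine ⟨fun i => N ^ (i : ℕ), fun s hs t ht h => ?_⟩
  have key : ∀ u : Fin m →₀ ℕ, Nat.ofDigits N (List.ofFn u) = ∑ i, u i * N ^ (i : ℕ) := by
    intro u
    rw [Nat.ofDigits_eq_sum_mapIdx, List.mapIdx_eq_ofFn, List.sum_ofFn]
    simp only [List.get_eq_getElem, List.getElem_ofFn]
    exact Fintype.sum_equiv (finCongr (by simp)) _ _ (fun i => rfl)
  have h' : List.ofFn s = List.ofFn t := by
    refine Nat.ofDigits_inj_of_len_eq hN1 (by simp) ?_ ?_ (by rw [key, key]; exact h)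
    · simpa [List.mem_ofFn] using hN s hs
    · simpa [List.mem_ofFn] using hN t ht
  exact DFunLike.coe_injective (List.ofFn_injective h')

variable {K : Type*} [Field K]

/-- Kronecker substitution: a substitution of powers of one variable for several variables that is
injective on the polynomials supported in a given finite set of monomials. -/
theorem exists_algHom_injOn_support {m : ℕ} (S : Finset (Fin m →₀ ℕ)) :
    ∃ φ : MvPolynomial (Fin m) K →ₐ[K] K[X], ∀ P, P.support ⊆ S → φ P = 0 → P = 0 := by
  obtain ⟨w, hw⟩ := exists_weight_injOn S
  refine ⟨MvPolynomial.aeval fun i => (X : K[X]) ^ w i, fun P hP h0 => ?_⟩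
  ext s
  by_cases hs : s ∈ S
  swap
  · simpa using fun h => hs (hP h)
  have h1 := congrArg (fun q : K[X] => q.coeff (∑ i, s i * w i)) h0
  simp only [MvPolynomial.aeval_def, MvPolynomial.eval₂_eq', coeff_zero] at h1
  rw [finsetSum_coeff] at h1
  rw [MvPolynomial.coeff_zero, ← h1, Finset.sum_eq_single s]
  · simp [← pow_mul, Finset.prod_pow_eq_pow_sum, mul_comm, Polynomial.coeff_X_pow]
  · intro t ht hts
    have hne : (∑ i, s i * w i) ≠ ∑ i, t i * w i := fun h => hts (hw (hP ht) hs h.symm)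
    simp only [← pow_mul, Finset.prod_pow_eq_pow_sum, algebraMap_eq, coeff_C_mul, coeff_X_pow]
    rw [if_neg, mul_zero]
    simpa [mul_comm] using hne
  · intro hs
    simp [MvPolynomial.notMem_support_iff.mp hs]

variable (K) in
/-- Every pair of `K`-linearly independent elements of `A` stays linearly independent under some
`K`-algebra homomorphism to the polynomials in one variable. -/
def SeparatesPairs (A : Type*) [CommRing A] [Algebra K A] : Prop :=
  ∀ P Q : A, LinearIndependent K ![P, Q] →
    ∃ φ : A →ₐ[K] K[X], LinearIndependent K ![φ P, φ Q]

/-- All combinations of `P` and `Q` are supported in one finite set of monomials, so a single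
Kronecker substitution kills none of the nonzero ones. -/
theorem separatesPairs_mvPolynomial (m : ℕ) : SeparatesPairs K (MvPolynomial (Fin m) K) := by
  classical
  intro P Q h
  obtain ⟨φ, hφ⟩ := exists_algHom_injOn_support (K := K) (P.support ∪ Q.support)
  refine ⟨φ, LinearIndependent.pair_iff.mpr fun a b hab => LinearIndependent.pair_iff.mp h a b
    (hφ _ ?_ (by simpa using hab))⟩
  refine MvPolynomial.support_add.trans (Finset.union_subset_union ?_ ?_) <;>
    exact MvPolynomial.support_smul

theorem SeparatesPairs.of_algEquiv {A B : Type*} [CommRing A] [Algebra K A] [CommRing B]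
    [Algebra K B] (e : A ≃ₐ[K] B) (h : SeparatesPairs K B) : SeparatesPairs K A := by
  intro P Q hPQ
  obtain ⟨φ, hφ⟩ := h (e P) (e Q) (LinearIndependent.pair_iff.mpr fun a b hab =>
    LinearIndependent.pair_iff.mp hPQ a b (e.injective (by simpa using hab)))
  exact ⟨φ.comp e.toAlgHom, hφ⟩

theorem transcendental_div_of_linearIndependent {P Q : K[X]} (h : LinearIndependent K ![P, Q]) :
    Transcendental K (algebraMap K[X] (RatFunc K) P / algebraMap K[X] (RatFunc K) Q) := by
  apply RatFunc.transcendental_of_ne_C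
  rintro ⟨c, hc⟩
  have hQ : Q ≠ 0 := h.ne_zero 1
  rw [div_eq_iff (RatFunc.algebraMap_ne_zero hQ), ← RatFunc.algebraMap_C, ← map_mul] at hc
  have := LinearIndependent.pair_iff.mp h 1 (-c) (by
    rw [RatFunc.algebraMap_injective K hc, Polynomial.smul_eq_C_mul, Polynomial.smul_eq_C_mul]
    simp)
  simp at this

/-- A field of transcendence degree one inside the fraction field of an integrally closed domain
with enough specializations to `K[X]` embeds in `K(X)`. -/
theorem exists_algHom_ratFunc {A F E : Type*} [CommRing A] [IsDomain A] [IsIntegrallyClosed A]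
    [Algebra K A] [Field F] [Algebra A F] [Algebra K F] [IsScalarTower K A F] [IsFractionRing A F]
    [Field E] [Algebra K E] (hA : SeparatesPairs K A) (i : E →ₐ[K] F) {t : E}
    (ht : Transcendental K t) (halg : Algebra.IsAlgebraic K⟮t⟯ E) :
    Nonempty (E →ₐ[K] RatFunc K) := by
  obtain ⟨P, Q, hQ, hPQ⟩ := IsFractionRing.div_surjective (A := A) (i t)
  have hQ0 : algebraMap A F Q ≠ 0 := by simpa using nonZeroDivisors.ne_zero hQ
  have hlin : LinearIndependent K ![P, Q] := by
    refine LinearIndependent.pair_iff.mpr fun a b hab => ?_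
    by_contra hne
    have h1 : algebraMap K F a * i t + algebraMap K F b = 0 := by
      have := congrArg (algebraMap A F) hab
      rw [← hPQ]
      field_simp
      simpa [Algebra.smul_def, ← IsScalarTower.algebraMap_apply, mul_comm] using this
    refine ht ⟨C a * X + C b, fun h => hne ?_, i.injective (by simpa using h1)⟩
    constructor
    · simpa using congrArg (fun q : K[X] => q.coeff 1) h
    · simpa using congrArg (fun q : K[X] => q.coeff 0) h
  obtain ⟨φ, hφ⟩ := hA P Q hlin
  let g : A →+* RatFunc K := (algebraMap K[X] (RatFunc K)).comp φ.toRingHom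
  have hg : ∀ x, g x = algebraMap K[X] (RatFunc K) (φ x) := fun _ => rfl
  have : (RingHom.ker g).IsPrime := RingHom.ker_isPrime g
  let S : Submonoid A := (RingHom.ker g).primeCompl
  have hSmem : ∀ s, s ∈ S ↔ g s ≠ 0 := fun s => Iff.rfl
  have hS : S ≤ nonZeroDivisors A := fun s hs =>
    mem_nonZeroDivisors_of_ne_zero fun h0 => (hSmem s).mp hs (by rw [h0, map_zero])
  -- `R` is the local ring, inside `F`, of the prime `ker g`. It is integrally closed, and `g`
  -- extends to it; the goal is to show that `i` maps `E` into `R`.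
  let R := Localization.subalgebra.ofField F S hS
  have : IsIntegrallyClosed R := isIntegrallyClosed_of_isLocalization R S hS
  have hu : ∀ s : S, IsUnit (g s) := fun s => isUnit_iff_ne_zero.mpr s.2
  let ψ : R →+* RatFunc K := IsLocalization.lift (M := S) hu
  have hψ : ∀ x : A, ψ (algebraMap A R x) = g x := fun x => IsLocalization.lift_eq hu x
  have hunit : ∀ x : R, ψ x ≠ 0 → (x : F)⁻¹ ∈ R := by
    intro x hx
    obtain ⟨p, q, rfl⟩ := IsLocalization.exists_mk'_eq S x
    have hp : p ∈ S := by
      rw [hSmem]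
      intro h
      exact hx (by simp [ψ, IsLocalization.lift_mk', h])
    have hmul := congrArg (fun y : R => (y : F)) (IsLocalization.mk'_spec R p q)
    simp only [MulMemClass.coe_mul] at hmul
    have hq0 : algebraMap A F q ≠ 0 := by
      simpa using nonZeroDivisors.ne_zero (hS q.2)
    refine ⟨q, p, hp, ?_⟩
    change _ * algebraMap A F q = algebraMap A F p at hmul
    rw [← hmul, mul_inv, mul_comm, mul_assoc, inv_mul_cancel₀ hq0, mul_one]
  have hK : ∀ c : K, algebraMap K F c = ((algebraMap A R (algebraMap K A c) : R) : F) := fun c =>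
    IsScalarTower.algebraMap_apply K A F c
  have hgK : ∀ c : K, g (algebraMap K A c) = algebraMap K (RatFunc K) c := by
    intro c
    rw [hg, AlgHom.commutes, ← IsScalarTower.algebraMap_apply]
  have hφQ : φ Q ≠ 0 := hφ.ne_zero 1
  have hQS : Q ∈ S := by
    rw [hSmem, hg]
    exact RatFunc.algebraMap_ne_zero hφQ
  let t' : R := ⟨i t, P, Q, hQS, by rw [← hPQ, div_eq_mul_inv]⟩
  have hψt : ψ t' = algebraMap K[X] (RatFunc K) (φ P) / algebraMap K[X] (RatFunc K) (φ Q) := by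
    rw [eq_div_iff (RatFunc.algebraMap_ne_zero hφQ), ← hg, ← hg, ← hψ, ← hψ, ← map_mul]
    congr 1
    ext
    change i t * algebraMap A F Q = algebraMap A F P
    rw [← hPQ, div_mul_cancel₀ _ hQ0]
  have htr : Transcendental K (ψ t') := by
    rw [hψt]
    exact transcendental_div_of_linearIndependent hφ
  have haev : ∀ f : K[X], ∃ y : R, (y : F) = i (aeval t f) ∧ ψ y = aeval (ψ t') f := by
    intro f
    refine ⟨f.eval₂ ((algebraMap A R).comp (algebraMap K A)) t', ?_, ?_⟩
    · rw [← Polynomial.aeval_algHom_apply, aeval_def]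
      change algebraMap R F _ = _
      rw [hom_eval₂]
      congr 1
      exact RingHom.ext fun c => (hK c).symm
    · rw [hom_eval₂, aeval_def]
      congr 1
      ext c
      simp [hψ, hgK]
  -- As `ψ t'` is transcendental, nonzero polynomials in `t` avoid the kernel of `ψ` and are units
  -- of `R`.
  have hKt : ∀ x ∈ K⟮t⟯, i x ∈ R := by
    intro x hx
    obtain ⟨f, h, rfl⟩ := (IntermediateField.mem_adjoin_simple_iff K x).mp hx
    obtain ⟨y, hy, -⟩ := haev f
    obtain ⟨z, hz, hz'⟩ := haev h
    rw [map_div₀, div_eq_mul_inv, ← hy, ← hz]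
    by_cases h0 : h = 0
    · subst h0
      rw [hz, map_zero, map_zero, inv_zero, mul_zero]
      exact R.zero_mem
    · refine R.mul_mem y.2 (hunit z ?_)
      rw [hz']
      exact fun h => h0 (transcendental_iff.mp htr _ h)
  -- `E` is integral over `K(t)`, which lies in the integrally closed ring `R`.
  have hmem : ∀ x : E, i x ∈ R := by
    intro x
    have hx : IsIntegral K⟮t⟯ x := (Algebra.IsAlgebraic.isAlgebraic x).isIntegral
    let κ : K⟮t⟯ →+* R := (i.toRingHom.comp (algebraMap K⟮t⟯ E)).codRestrict R.toSubring
      fun y => hKt y y.2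
    have := hx.map_of_comp_eq κ i.toRingHom (by ext; rfl)
    obtain ⟨y, hy⟩ := IsIntegrallyClosed.isIntegral_iff.mp this
    rw [← show algebraMap R F y = i x from hy]
    exact y.2
  let ι : E →+* R := i.toRingHom.codRestrict R.toSubring hmem
  refine ⟨{ ψ.comp ι with commutes' := fun c => ?_ }⟩
  have : ι (algebraMap K E c) = algebraMap A R (algebraMap K A c) := by
    ext
    change i (algebraMap K E c) = _
    rw [AlgHom.commutes, hK]
  simp [this, hψ, hgK]

end Specialization

end EssDim

namespace EssDim

/-! ### Automorphisms of `K(X)` and projective representations -/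

section Moebius

variable {K : Type*} [Field K] {G : Type*} [Group G]

/-- `M` lifts an injective homomorphism from `G` to `PGL₂(K)`. -/
structure IsFaithfulProjective (M : G → Matrix (Fin 2) (Fin 2) K) : Prop where
  det_ne_zero : ∀ g, (M g).det ≠ 0
  mul : ∀ g h, ∃ c : K, c ≠ 0 ∧ M (g * h) = c • (M g * M h)
  faithful : ∀ g, (∃ c : K, M g = c • 1) → g = 1

/-- The Möbius transformation given by `M` sends the variable `X` to `f`. -/
def IsMoebiusImage (M : Matrix (Fin 2) (Fin 2) K) (f : RatFunc K) : Prop :=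
  RatFunc.C (M 1 0) * RatFunc.X + RatFunc.C (M 1 1) ≠ 0 ∧
    RatFunc.C (M 0 0) * RatFunc.X + RatFunc.C (M 0 1) =
      (RatFunc.C (M 1 0) * RatFunc.X + RatFunc.C (M 1 1)) * f

theorem IsMoebiusImage.eq_smul {M N : Matrix (Fin 2) (Fin 2) K} {f : RatFunc K}
    (hM : IsMoebiusImage M f) (hN : IsMoebiusImage N f) (hM0 : M.det ≠ 0) (hN0 : N.det ≠ 0) :
    ∃ c : K, c ≠ 0 ∧ N = c • M := by
  have h : (RatFunc.C (M 0 0) * RatFunc.X + RatFunc.C (M 0 1)) *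
      (RatFunc.C (N 1 0) * RatFunc.X + RatFunc.C (N 1 1)) =
      (RatFunc.C (N 0 0) * RatFunc.X + RatFunc.C (N 0 1)) *
      (RatFunc.C (M 1 0) * RatFunc.X + RatFunc.C (M 1 1)) := by
    rw [hM.2, hN.2]; ring
  simp only [← RatFunc.algebraMap_X, ← RatFunc.algebraMap_C, ← map_mul, ← map_add] at h
  have h := RatFunc.algebraMap_injective K h
  have e : ∀ a b c d : K, (Polynomial.C a * Polynomial.X + Polynomial.C b) *
      (Polynomial.C c * Polynomial.X + Polynomial.C d) = Polynomial.C (a * c) * Polynomial.X ^ 2 +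
      Polynomial.C (a * d + b * c) * Polynomial.X + Polynomial.C (b * d) := by
    intro a b c d
    simp only [map_mul, map_add]
    ring
  rw [e, e] at h
  have h2 : M 0 0 * N 1 0 = N 0 0 * M 1 0 := by
    have := congrArg (fun q => Polynomial.coeff q 2) h
    simpa [Polynomial.coeff_X, Polynomial.coeff_C, -map_mul, -map_add] using this
  have h1 : M 0 0 * N 1 1 + M 0 1 * N 1 0 = N 0 0 * M 1 1 + N 0 1 * M 1 0 := by
    have := congrArg (fun q => Polynomial.coeff q 1) h
    simpa [Polynomial.coeff_X, Polynomial.coeff_C, -map_mul, -map_add] using this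
  have h0 : M 0 1 * N 1 1 = N 0 1 * M 1 1 := by
    have := congrArg (fun q => Polynomial.coeff q 0) h
    simpa [Polynomial.coeff_X, Polynomial.coeff_C, -map_mul, -map_add] using this
  -- The scalar is forced: if `N = c • M`, the bracket equals `c * M.det`.
  have key : N = (M.det⁻¹ * (M 0 0 * N 1 1 - M 1 0 * N 0 1)) • M := by
    rw [mul_smul, eq_inv_smul_iff₀ hM0]
    ext i j
    fin_cases i <;> fin_cases j <;>
      simp only [Matrix.smul_apply, smul_eq_mul, Matrix.det_fin_two, Fin.zero_eta, Fin.mk_one]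
    · linear_combination -M 0 0 * h1 + M 0 1 * h2
    · linear_combination - M 0 0 * h0
    · linear_combination - M 1 0 * h1 + M 1 1 * h2
    · linear_combination - M 1 0 * h0
  refine ⟨_, fun h0 => hN0 ?_, key⟩
  rw [key, h0, zero_smul, Matrix.det_zero]

theorem IsMoebiusImage.mul {M N : Matrix (Fin 2) (Fin 2) K} {f : RatFunc K}
    (e : RatFunc K ≃ₐ[K] RatFunc K) (hM : IsMoebiusImage M f) (hN : IsMoebiusImage N (e RatFunc.X)) :
    IsMoebiusImage (M * N) (e f) := by
  have hC : ∀ c, e (RatFunc.C c) = RatFunc.C c := fun c => e.commutes c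
  obtain ⟨h1, h2⟩ := hM
  have h1' := (map_ne_zero_iff e e.injective).mpr h1
  have h2' := congrArg e h2
  simp only [map_add, map_mul, hC] at h1' h2'
  obtain ⟨h3, h4⟩ := hN
  have key : ∀ i, RatFunc.C ((M * N) i 0) * RatFunc.X + RatFunc.C ((M * N) i 1) =
      (RatFunc.C (M i 0) * e RatFunc.X + RatFunc.C (M i 1)) *
        (RatFunc.C (N 1 0) * RatFunc.X + RatFunc.C (N 1 1)) := by
    intro i
    simp only [Matrix.mul_apply, Fin.sum_univ_two, map_add, map_mul]
    linear_combination (RatFunc.C (M i 0)) * h4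
  constructor
  · rw [key]
    exact mul_ne_zero h1' h3
  · rw [key, key, h2']
    ring

/-- The image `f` of `X` generates `K(X)`, and the degree of `K(X)` over `K(f)` is the larger of the
degrees of numerator and denominator, so both are at most one. A vanishing determinant would make
`f` constant. -/
theorem exists_isMoebiusImage (e : RatFunc K ≃ₐ[K] RatFunc K) :
    ∃ M : Matrix (Fin 2) (Fin 2) K, M.det ≠ 0 ∧ IsMoebiusImage M (e RatFunc.X) := by
  set f := e RatFunc.X with hf
  have hconst : ¬ ∃ c, f = RatFunc.C c := by
    rintro ⟨c, hc⟩
    have h1 : (RatFunc.X : RatFunc K) = RatFunc.C c := by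
      apply e.injective
      rw [← hf, hc]
      exact (e.commutes c).symm
    have := congrArg RatFunc.intDegree h1
    simp at this
  have htop : K⟮f⟯ = ⊤ := by
    have h1 : (K⟮(RatFunc.X : RatFunc K)⟯).map e.toAlgHom = K⟮f⟯ := by
      rw [IntermediateField.adjoin_map]
      simp [hf]
    rw [← h1, RatFunc.adjoin_X, ← AlgHom.fieldRange_eq_map]
    exact AlgHom.fieldRange_eq_top.mpr e.surjective
  have hdeg := RatFunc.finrank_eq_max_natDegree f
  rw [htop, IntermediateField.finrank_top] at hdeg
  have hn : f.num.natDegree ≤ 1 := by rw [hdeg]; exact le_max_left _ _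
  have hd : f.denom.natDegree ≤ 1 := by rw [hdeg]; exact le_max_right _ _
  have hn' := Polynomial.eq_X_add_C_of_natDegree_le_one hn
  have hd' := Polynomial.eq_X_add_C_of_natDegree_le_one hd
  have en : RatFunc.C (f.num.coeff 1) * RatFunc.X + RatFunc.C (f.num.coeff 0) =
      algebraMap _ (RatFunc K) f.num := by
    conv_rhs => rw [hn']
    simp
  have ed : RatFunc.C (f.denom.coeff 1) * RatFunc.X + RatFunc.C (f.denom.coeff 0) =
      algebraMap _ (RatFunc K) f.denom := by
    conv_rhs => rw [hd']
    simp
  have hd0 := RatFunc.algebraMap_ne_zero (K := K) f.denom_ne_zero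
  have hnd : algebraMap _ (RatFunc K) f.num = algebraMap _ (RatFunc K) f.denom * f := by
    rw [mul_comm]
    exact (div_eq_iff hd0).mp (RatFunc.num_div_denom f)
  refine ⟨!![f.num.coeff 1, f.num.coeff 0; f.denom.coeff 1, f.denom.coeff 0], fun h0 => ?_, ?_, ?_⟩
  · obtain ⟨v, hv0, hv⟩ := Matrix.exists_vecMul_eq_zero_iff.mpr h0
    have e0 := congrFun hv 0
    have e1 := congrFun hv 1
    simp [Matrix.vecMul, dotProduct, Fin.sum_univ_two] at e0 e1
    have h1 : RatFunc.C (v 0) * algebraMap _ (RatFunc K) f.num +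
        RatFunc.C (v 1) * algebraMap _ (RatFunc K) f.denom = 0 := by
      rw [← en, ← ed]
      have e0' := congrArg (RatFunc.C (K := K)) e0
      have e1' := congrArg (RatFunc.C (K := K)) e1
      simp only [map_add, map_mul, map_zero] at e0' e1'
      linear_combination RatFunc.X * e0' + e1'
    rw [hnd] at h1
    have h2 : RatFunc.C (v 0) * f + RatFunc.C (v 1) = 0 := by
      apply mul_left_cancel₀ hd0
      linear_combination h1
    by_cases hv00 : v 0 = 0
    · rw [hv00] at h2
      have hv1 : v 1 = 0 := by simpa using h2
      exact hv0 (by ext i; fin_cases i <;> simp [hv00, hv1])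
    · refine hconst ⟨-v 1 / v 0, ?_⟩
      have : RatFunc.C (v 0) ≠ 0 := by simpa using hv00
      rw [map_div₀, eq_div_iff this, map_neg]
      linear_combination h2
  · simpa [ed] using f.denom_ne_zero
  · simpa [ed, en] using hnd

theorem exists_isFaithfulProjective (θ : G →* (RatFunc K ≃ₐ[K] RatFunc K))
    (hθ : Function.Injective θ) :
    ∃ M : G → Matrix (Fin 2) (Fin 2) K, IsFaithfulProjective M := by
  -- Substitution reverses products, as in `IsMoebiusImage.mul`; the inverse restores their order.
  choose M hdet hM using fun g : G => exists_isMoebiusImage (θ g⁻¹)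
  refine ⟨M, hdet, fun g h => ?_, fun g ⟨c, hc⟩ => ?_⟩
  · have h1 := (hM g).mul (θ h⁻¹) (hM h)
    have h2 : IsMoebiusImage (M (g * h)) (θ h⁻¹ (θ g⁻¹ RatFunc.X)) := by
      have := hM (g * h)
      rwa [mul_inv_rev, map_mul] at this
    exact h1.eq_smul h2 (by rw [Matrix.det_mul]; exact mul_ne_zero (hdet g) (hdet h))
      (hdet (g * h))
  · have hc0 : c ≠ 0 := by
      rintro rfl
      exact hdet g (by rw [hc, zero_smul, Matrix.det_zero])
    have h1 := (hM g).2
    rw [hc] at h1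
    simp only [Matrix.smul_apply, Matrix.one_apply_eq, smul_eq_mul, mul_one, ne_eq, zero_ne_one,
      not_false_eq_true, Matrix.one_apply_ne, mul_zero, map_zero, add_zero, one_ne_zero, zero_mul,
      zero_add] at h1
    have h2 : θ g⁻¹ RatFunc.X = RatFunc.X :=
      (mul_left_cancel₀ ((map_ne_zero RatFunc.C).mpr hc0) h1).symm
    have h3 : θ g⁻¹ = 1 := by
      apply AlgEquiv.ext
      intro x
      have hx : x ∈ K⟮(RatFunc.X : RatFunc K)⟯ := by rw [RatFunc.adjoin_X]; trivial
      induction hx using IntermediateField.adjoin_induction with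
      | mem y hy => rw [Set.mem_singleton_iff.mp hy, h2]; rfl
      | algebraMap y => exact (θ g⁻¹).commutes y
      | add y z _ _ hy hz => rw [map_add, hy, hz, map_add]
      | inv y _ hy => rw [map_inv₀, hy, map_inv₀]
      | mul y z _ _ hy hz => rw [map_mul, hy, hz, map_mul]
    have h4 : g⁻¹ = 1 := hθ (by rw [h3, map_one])
    exact inv_eq_one.mp h4

end Moebius

end EssDim

namespace EssDim

/-! ### Elementary abelian `p`-subgroups of `PGL₂(K)` and their normalizers -/

section ProjectiveGroups

variable {K : Type*} [Field K]

theorem matrix_two_eq_smul_one_iff {A : Matrix (Fin 2) (Fin 2) K} :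
    (∃ c : K, A = c • 1) ↔ A 0 0 = A 1 1 ∧ A 0 1 = 0 ∧ A 1 0 = 0 := by
  constructor
  · rintro ⟨c, rfl⟩
    simp
  · rintro ⟨h1, h2, h3⟩
    refine ⟨A 1 1, ?_⟩
    ext i j
    fin_cases i <;> fin_cases j <;> simp [h1, h2, h3]

/-- With `M 1 0 ≠ 0` the first basis vector is cyclic for `M`, so the centralizer of `M` is `K[M]`.
-/
theorem exists_eq_add_smul_of_commute {A M : Matrix (Fin 2) (Fin 2) K} (hM : M 1 0 ≠ 0)
    (h : A * M = M * A) : ∃ α β : K, A = α • 1 + β • M := by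
  have h0 := congrFun (congrFun h 0) 0
  have h1 := congrFun (congrFun h 1) 0
  simp only [Matrix.mul_apply, Fin.sum_univ_two] at h0 h1
  refine ⟨A 0 0 - A 1 0 / M 1 0 * M 0 0, A 1 0 / M 1 0, ?_⟩
  ext i j
  fin_cases i <;> fin_cases j <;> simp <;> field_simp
  · linear_combination h0
  · linear_combination h1

/-- For invertible `A`, the matrix `S` is conjugate to a multiple of a transvection, so its only
eigenline is the first coordinate line, and `A` must preserve that line. Comparing entries avoids
inverting `A`. -/
theorem apply_one_zero_eq_zero {A S : Matrix (Fin 2) (Fin 2) K} {c : K} (hS : S 1 0 = 0)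
    (h : A * !![1, 1; 0, 1] = c • (S * A)) : A 1 0 = 0 := by
  have h0 := congrFun (congrFun h 1) 0
  have h1 := congrFun (congrFun h 1) 1
  simp [Matrix.mul_apply, Fin.sum_univ_two, hS] at h0 h1
  by_contra hA
  have h2 : c * S 1 1 = 1 := mul_right_cancel₀ hA (by linear_combination -h0)
  exact hA (by linear_combination h1 + A 1 1 * h2)

theorem apply_zero_zero_eq {A : Matrix (Fin 2) (Fin 2) K} {c : K} (hA : A.det ≠ 0)
    (h : A * !![1, 1; 0, 1] = c • (!![1, 1; 0, 1] * A)) : A 1 0 = 0 ∧ A 0 0 = A 1 1 := by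
  have h10 := apply_one_zero_eq_zero (by simp) h
  refine ⟨h10, ?_⟩
  have h0 := congrFun (congrFun h 0) 1
  have h1 := congrFun (congrFun h 1) 1
  simp only [Matrix.mul_apply, Fin.sum_univ_two, Matrix.smul_apply, smul_eq_mul, h10] at h0 h1
  simp at h0 h1
  have hA1 : A 1 1 ≠ 0 := by
    intro h
    exact hA (by rw [Matrix.det_fin_two, h, h10]; ring)
  have hc : c = 1 := mul_right_cancel₀ hA1 (by linear_combination -h1)
  subst hc
  linear_combination h0

/-- Jordan form: with `N = M - e`, the columns of `P` are `N v / e` and `v` for a standard basis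
vector `v` with `N v ≠ 0`. -/
theorem exists_conj_eq_smul_unipotent {M : Matrix (Fin 2) (Fin 2) K} {e : K} (he : e ≠ 0)
    (hM : ¬ ∃ c : K, M = c • 1) (hnil : IsNilpotent (M - e • 1)) :
    ∃ P : Matrix (Fin 2) (Fin 2) K, P.det ≠ 0 ∧ P⁻¹ * M * P = e • !![1, 1; 0, 1] := by
  obtain ⟨N, hN⟩ : ∃ N, N = M - e • 1 := ⟨_, rfl⟩
  obtain rfl : M = e • 1 + N := by rw [hN]; abel
  rw [← hN] at hnil
  have htr : N 0 0 + N 1 1 = 0 := by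
    rw [← Matrix.trace_fin_two]
    exact (Matrix.isNilpotent_trace_of_isNilpotent hnil).eq_zero
  have hdet : N 0 0 * N 1 1 - N 0 1 * N 1 0 = 0 := by
    obtain ⟨k, hk⟩ := hnil
    rw [← Matrix.det_fin_two]
    apply eq_zero_of_pow_eq_zero (n := k + 1)
    rw [← Matrix.det_pow, pow_succ, hk, zero_mul, Matrix.det_zero]
  have suff : ∀ P : Matrix (Fin 2) (Fin 2) K, P.det ≠ 0 →
      (e • 1 + N) * P = P * (e • !![1, 1; 0, 1]) →
      ∃ P : Matrix (Fin 2) (Fin 2) K, P.det ≠ 0 ∧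
        P⁻¹ * (e • 1 + N) * P = e • !![1, 1; 0, 1] := by
    intro P hP h
    refine ⟨P, hP, ?_⟩
    rw [mul_assoc, h, ← mul_assoc, Matrix.nonsing_inv_mul P (isUnit_iff_ne_zero.mpr hP), one_mul]
  by_cases h10 : N 1 0 = 0
  · have h11 : N 1 1 = 0 := by
      have : N 1 1 ^ 2 = 0 := by linear_combination N 1 1 * htr - hdet - N 0 1 * h10
      simpa using this
    have h00 : N 0 0 = 0 := by linear_combination htr - h11
    have h01 : N 0 1 ≠ 0 := by
      intro h01
      exact hM (matrix_two_eq_smul_one_iff.mpr (by simp [h10, h11, h00, h01]))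
    refine suff !![N 0 1 / e, 0; 0, 1] (by simp [Matrix.det_fin_two, h01, he]) ?_
    ext i j
    fin_cases i <;> fin_cases j <;>
      simp [Matrix.mul_apply, Fin.sum_univ_two, h00, h10, h11] <;> field_simp
  · refine suff !![N 0 0 / e, 1; N 1 0 / e, 0] (by simp [Matrix.det_fin_two, h10, he]) ?_
    ext i j
    fin_cases i <;> fin_cases j <;>
      simp [Matrix.mul_apply, Fin.sum_univ_two] <;> field_simp
    · linear_combination N 0 0 * htr - hdet
    · ring
    · linear_combination htr

variable {G : Type*} [Group G] {M : G → Matrix (Fin 2) (Fin 2) K}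

namespace IsFaithfulProjective

variable (hM : IsFaithfulProjective M)
include hM

theorem conj {P : Matrix (Fin 2) (Fin 2) K} (hP : P.det ≠ 0) :
    IsFaithfulProjective fun g => P⁻¹ * M g * P := by
  have h1 : P * P⁻¹ = 1 := Matrix.mul_nonsing_inv P (isUnit_iff_ne_zero.mpr hP)
  have h2 : P⁻¹ * P = 1 := Matrix.nonsing_inv_mul P (isUnit_iff_ne_zero.mpr hP)
  refine ⟨fun g => ?_, fun g k => ?_, fun g ⟨c, hc⟩ => ?_⟩
  · have hPi : P⁻¹.det ≠ 0 := fun h => by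
      have := congrArg Matrix.det h1
      simp [h] at this
    rw [Matrix.det_mul, Matrix.det_mul]
    exact mul_ne_zero (mul_ne_zero hPi (hM.det_ne_zero g)) hP
  · obtain ⟨c, hc, h⟩ := hM.mul g k
    refine ⟨c, hc, ?_⟩
    have : P⁻¹ * M g * P * (P⁻¹ * M k * P) = P⁻¹ * (M g * M k) * P := by
      calc _ = P⁻¹ * M g * (P * P⁻¹) * M k * P := by simp only [mul_assoc]
        _ = _ := by rw [h1, mul_one]; simp only [mul_assoc]
    rw [h, this]
    simp
  · refine hM.faithful g ⟨c, ?_⟩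
    calc M g = (P * P⁻¹) * M g * (P * P⁻¹) := by rw [h1, one_mul, mul_one]
      _ = P * (P⁻¹ * M g * P) * P⁻¹ := by simp only [mul_assoc]
      _ = c • 1 := by rw [hc]; simp [h1]

theorem pow (g : G) (k : ℕ) : ∃ c : K, c ≠ 0 ∧ M (g ^ k) = c • M g ^ k := by
  induction k with
  | zero =>
    obtain ⟨c, hc, h⟩ := hM.mul 1 1
    refine ⟨c⁻¹, inv_ne_zero hc, ?_⟩
    have hu : IsUnit (M 1) := (Matrix.isUnit_iff_isUnit_det _).mpr
      (isUnit_iff_ne_zero.mpr (hM.det_ne_zero 1))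
    rw [mul_one, ← Matrix.mul_smul] at h
    have : M 1 * 1 = M 1 * (c • M 1) := by rw [mul_one]; exact h
    rw [pow_zero, pow_zero, hu.mul_left_cancel this, inv_smul_smul₀ hc]
  | succ k ih =>
    obtain ⟨c, hc, h⟩ := ih
    obtain ⟨d, hd, h'⟩ := hM.mul (g ^ k) g
    exact ⟨d * c, mul_ne_zero hd hc, by rw [pow_succ, h', h, pow_succ, Matrix.smul_mul, mul_smul]⟩

theorem exists_one_eq_smul : ∃ c : K, c ≠ 0 ∧ M 1 = c • 1 := by
  simpa using hM.pow 1 0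

theorem exists_mul_eq_smul_mul {g h k l : G} (e : g * h = k * l) :
    ∃ c : K, c ≠ 0 ∧ M g * M h = c • (M k * M l) := by
  obtain ⟨c, hc, h1⟩ := hM.mul g h
  obtain ⟨d, hd, h2⟩ := hM.mul k l
  refine ⟨c⁻¹ * d, mul_ne_zero (inv_ne_zero hc) hd, ?_⟩
  rw [mul_smul, ← h2, ← e, h1, inv_smul_smul₀ hc]

theorem exists_pow_eq_smul_one {g : G} {k : ℕ} (hg : g ^ k = 1) :
    ∃ c : K, c ≠ 0 ∧ M g ^ k = c • 1 := by
  obtain ⟨c, hc, h⟩ := hM.pow g k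
  obtain ⟨d, hd, h'⟩ := hM.exists_one_eq_smul
  refine ⟨c⁻¹ * d, mul_ne_zero (inv_ne_zero hc) hd, ?_⟩
  rw [mul_smul, ← h', ← hg, h, inv_smul_smul₀ hc]

theorem pow_eq_one_of_pow_eq_smul_one {g : G} {k : ℕ} {c : K} (h : M g ^ k = c • 1) :
    g ^ k = 1 := by
  obtain ⟨d, -, h'⟩ := hM.pow g k
  exact hM.faithful _ ⟨d * c, by rw [h', h, mul_smul]⟩

theorem pow_apply_of_upper {g : G} (h10 : M g 1 0 = 0) (k : ℕ) :
    M (g ^ k) 1 0 = 0 ∧ M (g ^ k) 0 0 = (M g 0 0 / M g 1 1) ^ k * M (g ^ k) 1 1 := by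
  have h11 : M g 1 1 ≠ 0 := fun h => hM.det_ne_zero g (by rw [Matrix.det_fin_two, h, h10]; ring)
  induction k with
  | zero =>
    obtain ⟨c, -, h⟩ := hM.exists_one_eq_smul
    simp [h]
  | succ k ih =>
    obtain ⟨c, -, h⟩ := hM.mul (g ^ k) g
    rw [pow_succ, h]
    simp only [Matrix.smul_apply, Matrix.mul_apply, Fin.sum_univ_two, h10, ih.1, ih.2, smul_eq_mul]
    refine ⟨by ring, ?_⟩
    rw [pow_succ]
    field_simp
    ring

/-- The off-diagonal entry of the `p`-th power carries a factor `p`, so that power is scalar. -/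
theorem pow_char_eq_one_of_upper {p : ℕ} [CharP K p] {g : G} (h10 : M g 1 0 = 0)
    (h00 : M g 0 0 = M g 1 1) : g ^ p = 1 := by
  have key : ∀ k : ℕ, M g ^ k = !![M g 1 1 ^ k, k * M g 1 1 ^ (k - 1) * M g 0 1; 0, M g 1 1 ^ k] := by
    intro k
    induction k with
    | zero => ext i j; fin_cases i <;> fin_cases j <;> simp
    | succ k ih =>
      rw [pow_succ, ih]
      ext i j
      fin_cases i <;> fin_cases j <;> simp [Matrix.mul_apply, Fin.sum_univ_two, h10, h00, pow_succ]
      rcases k with _ | k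
      · simp
      · simp only [Nat.add_sub_cancel, pow_succ]
        ring
  refine hM.pow_eq_one_of_pow_eq_smul_one (c := M g 1 1 ^ p) ?_
  rw [key, CharP.cast_eq_zero, zero_mul, zero_mul]
  ext i j
  fin_cases i <;> fin_cases j <;> simp

/-- A group with a faithful projective representation in dimension two in which an elementary
abelian normal `p`-subgroup consists of multiples of upper unitriangular matrices. -/
theorem of_unipotent {p : ℕ} [Fact p.Prime] [CharP K p] [Algebra (ZMod p) K]
    {V : Type*} [AddCommGroup V] [Module (ZMod p) V] {r : ℕ} (b : Module.Basis (Fin r) (ZMod p) V)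
    {σ : Multiplicative V →* G} (hσ : Function.Injective σ) {τ : G} {n : ℕ} (hn : 0 < n)
    (hp : ¬ p ∣ n) (hτ : orderOf τ = n) (hconj : ∀ x, ∃ y, τ * σ x = σ y * τ)
    (heven : ∀ m, n = 2 * m → ∀ x, τ ^ m * σ x = σ x * τ ^ m)
    {e : K} (he : e ≠ 0) {x₀ : Multiplicative V} (hx₀ : M (σ x₀) = e • !![1, 1; 0, 1]) :
    Odd n ∧ (∃ z : K, IsPrimitiveRoot z n) ∧ (r : Cardinal) ≤ Module.rank (ZMod p) K := by
  have hcomm : ∀ g, g * σ x₀ = σ x₀ * g → M g 1 0 = 0 ∧ M g 0 0 = M g 1 1 := by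
    intro g hg
    obtain ⟨c, -, hc⟩ := hM.exists_mul_eq_smul_mul hg
    refine apply_zero_zero_eq (c := c) (hM.det_ne_zero g) ?_
    rw [hx₀, Matrix.mul_smul, Matrix.smul_mul, smul_comm] at hc
    exact smul_right_injective _ he hc
  have hσu : ∀ x, M (σ x) 1 0 = 0 ∧ M (σ x) 0 0 = M (σ x) 1 1 := fun x =>
    hcomm _ (by rw [← map_mul, mul_comm, map_mul])
  have hσ1 : ∀ x, M (σ x) 1 1 ≠ 0 := fun x h => hM.det_ne_zero (σ x) (by
    rw [Matrix.det_fin_two, h, (hσu x).1]; ring)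
  have hτ10 : M τ 1 0 = 0 := by
    obtain ⟨y, hy⟩ := hconj x₀
    obtain ⟨c, -, hc⟩ := hM.exists_mul_eq_smul_mul hy
    refine apply_one_zero_eq_zero (S := M (σ y)) (c := e⁻¹ * c) (hσu y).1 ?_
    rw [mul_smul, ← hc, hx₀, Matrix.mul_smul, inv_smul_smul₀ he]
  have hroot : IsPrimitiveRoot (M τ 0 0 / M τ 1 1) n := by
    constructor
    · obtain ⟨c, hc, h⟩ := hM.exists_one_eq_smul
      have h1 := (hM.pow_apply_of_upper hτ10 n).2
      rw [← hτ, pow_orderOf_eq_one, h, hτ] at h1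
      simpa [hc] using h1
    · intro k hk
      -- If the ratio has `k`-th power one, then `τ ^ k` has equal diagonal entries and order
      -- dividing `p`; hence `n ∣ k * p`, and `p ∤ n` gives `n ∣ k`.
      obtain ⟨h1, h2⟩ := hM.pow_apply_of_upper hτ10 k
      rw [hk, one_mul] at h2
      have h3 := hM.pow_char_eq_one_of_upper (p := p) h1 h2
      rw [← pow_mul] at h3
      have h4 := orderOf_dvd_of_pow_eq_one h3
      rw [hτ] at h4
      exact (((Nat.Prime.coprime_iff_not_dvd Fact.out).mpr hp).symm).dvd_of_dvd_mul_right h4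
  refine ⟨?_, ⟨_, hroot⟩, ?_⟩
  · rw [← Nat.not_even_iff_odd]
    rintro ⟨m, hm⟩
    have h0 := hcomm _ (heven m (by omega) x₀)
    have h1 := (hM.pow_apply_of_upper hτ10 m).2
    have h11 : M (τ ^ m) 1 1 ≠ 0 := fun h => hM.det_ne_zero (τ ^ m) (by
      rw [Matrix.det_fin_two, h, h0.1]; ring)
    rw [h0.2] at h1
    have h2 := mul_right_cancel₀ h11 ((one_mul _).trans h1)
    have := Nat.le_of_dvd (by omega) (hroot.dvd_of_pow_eq_one m h2.symm)
    omega
  -- Normalized to diagonal one, the matrices of `V` multiply by adding their corner entries.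
  · let s : V →+ K :=
      { toFun := fun v => M (σ (.ofAdd v)) 0 1 / M (σ (.ofAdd v)) 1 1
        map_zero' := by
          obtain ⟨c, -, h⟩ := hM.exists_one_eq_smul
          simp [h]
        map_add' := fun v w => by
          obtain ⟨c, hc, h⟩ := hM.mul (σ (.ofAdd v)) (σ (.ofAdd w))
          have h1 := hσ1 (.ofAdd v)
          have h2 := hσ1 (.ofAdd w)
          rw [ofAdd_add, map_mul, h]
          simp only [Matrix.smul_apply, Matrix.mul_apply, Fin.sum_univ_two, (hσu _).1, (hσu _).2,
            smul_eq_mul]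
          field_simp
          ring }
    have hs : ∀ v, s v = M (σ (.ofAdd v)) 0 1 / M (σ (.ofAdd v)) 1 1 := fun _ => rfl
    have hinj : Function.Injective (s.toZModLinearMap p) := by
      rw [injective_iff_map_eq_zero]
      intro v hv
      have h0 : M (σ (.ofAdd v)) 0 1 = 0 := by
        have : s v = 0 := hv
        simpa [hs, hσ1] using this
      have h1 := hM.faithful _ (matrix_two_eq_smul_one_iff.mpr ⟨(hσu _).2, h0, (hσu _).1⟩)
      exact Multiplicative.ofAdd.injective (hσ (h1.trans (map_one σ).symm))
    have := (b.linearIndependent.map' _ (LinearMap.ker_eq_bot.mpr hinj)).cardinal_lift_le_rank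
    simpa using this

/-- In characteristic two, if some element of an elementary abelian normal `2`-subgroup has an
irrational fixed point on the projective line, then every element normalizing the subgroup squares
to the identity. -/
theorem sq_eq_one_of_not_isSquare [CharP K 2] {g τ k : G} {c : K} (hc : ¬ IsSquare c)
    (hg : M g ^ 2 = c • 1) (hk : k * g = g * k) (hτ : τ * g = k * τ) : τ ^ 2 = 1 := by
  have two : (2 : K) = 0 := CharTwo.two_eq_zero
  have hg2 : M g * M g = c • 1 := by rw [← pow_two, hg]
  have hne : M g 1 0 ≠ 0 := by
    intro h
    have h0 := congrFun (congrFun hg2 0) 0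
    simp [Matrix.mul_apply, Fin.sum_univ_two, h] at h0
    exact hc ⟨_, h0.symm⟩
  have hsq : ∀ α β : K, (α • 1 + β • M g) * (α • 1 + β • M g) = (α ^ 2 + β ^ 2 * c) •
      (1 : Matrix (Fin 2) (Fin 2) K) := by
    intro α β
    simp only [mul_add, add_mul, Matrix.smul_mul, Matrix.mul_smul, one_mul, mul_one, hg2, smul_smul]
    have : (α * β) • M g + (β * α) • M g = 0 := by
      rw [mul_comm β α, ← add_smul, ← two_mul, two, zero_mul, zero_smul]
    calc _ = (α * α) • 1 + (β * (β * c)) • 1 + ((α * β) • M g + (β * α) • M g) := by abel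
      _ = _ := by rw [this, add_zero, ← add_smul]; ring_nf
  -- The commutation scalar `d` satisfies `d ^ 2 = 1` by determinants, so `d = 1` in characteristic
  -- two.
  have hkg : M k * M g = M g * M k := by
    obtain ⟨d, -, hd⟩ := hM.exists_mul_eq_smul_mul hk
    have h1 := congrArg Matrix.det hd
    rw [Matrix.det_smul, Matrix.det_mul, Matrix.det_mul, Fintype.card_fin] at h1
    have h2 : (d - 1) ^ 2 = 0 := by
      have : d ^ 2 = 1 := mul_right_cancel₀
        (mul_ne_zero (hM.det_ne_zero g) (hM.det_ne_zero k)) (by linear_combination -h1)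
      linear_combination this + (1 - d) * two
    have h3 : d = 1 := sub_eq_zero.mp (by simpa using h2)
    rw [hd, h3, one_smul]
  obtain ⟨α, β, hαβ⟩ := exists_eq_add_smul_of_commute hne hkg
  obtain ⟨d, hd, h⟩ := hM.exists_mul_eq_smul_mul hτ
  have hu : IsUnit (M τ) := (Matrix.isUnit_iff_isUnit_det _).mpr
    (isUnit_iff_ne_zero.mpr (hM.det_ne_zero τ))
  -- Conjugation by `M τ` preserves the square `c` of `M g`. Since `c` is not a square, this forces
  -- `d * β = 1` and `d * α = 0`, so `M τ` commutes with `M g` and lies in `K[M g]`, where squares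
  -- are scalar.
  have h1 : c = (d * α) ^ 2 + (d * β) ^ 2 * c := by
    have e1 : M τ * M g * M g = c • M τ := by rw [mul_assoc, hg2]; simp
    have e2 : M τ * M g * M g = (d ^ 2) • (M k * M k * M τ) := by
      rw [h, Matrix.smul_mul, mul_assoc, h, Matrix.mul_smul, smul_smul, ← mul_assoc, pow_two]
    rw [hαβ, hsq, e1, Matrix.smul_mul, one_mul, smul_smul] at e2
    obtain ⟨i, j, hij⟩ : ∃ i j, M τ i j ≠ 0 := by
      by_contra! h0
      exact hM.det_ne_zero τ (by rw [Matrix.det_fin_two, h0 0 0, h0 0 1]; ring)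
    have e3 := congrFun (congrFun e2 i) j
    simp only [Matrix.smul_apply, smul_eq_mul] at e3
    have := mul_right_cancel₀ hij e3
    linear_combination this
  have hβ : d * β = 1 := by
    by_contra hne1
    have : 1 + d * β ≠ 0 := by
      intro h0
      exact hne1 (by linear_combination h0 - two)
    refine hc ⟨d * α / (1 + d * β), ?_⟩
    field_simp
    linear_combination h1 + (d ^ 2 * β ^ 2 * c + d * β * c) * two
  have hα : d * α = 0 := by
    rw [hβ] at h1
    have : (d * α) ^ 2 = 0 := by linear_combination -h1
    simpa using this
  have hcomm : M τ * M g = M g * M τ := by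
    rw [h, hαβ, ← Matrix.smul_mul, smul_add, smul_smul, smul_smul, hα, hβ, zero_smul, zero_add,
      one_smul]
  obtain ⟨α', β', h'⟩ := exists_eq_add_smul_of_commute hne hcomm
  exact hM.pow_eq_one_of_pow_eq_smul_one (c := α' ^ 2 + β' ^ 2 * c) (by rw [pow_two, h', hsq])

theorem odd_and_exists_isPrimitiveRoot_and_le_rank {p : ℕ} [Fact p.Prime] [CharP K p]
    [Algebra (ZMod p) K] {V : Type*} [AddCommGroup V] [Module (ZMod p) V] {r : ℕ} (hr : 0 < r)
    (b : Module.Basis (Fin r) (ZMod p) V) {σ : Multiplicative V →* G} (hσ : Function.Injective σ)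
    {τ : G} {n : ℕ} (hn : 0 < n) (hp : ¬ p ∣ n) (hτ : orderOf τ = n)
    (hconj : ∀ x, ∃ y, τ * σ x = σ y * τ)
    (heven : ∀ m, n = 2 * m → ∀ x, τ ^ m * σ x = σ x * τ ^ m) :
    Odd n ∧ (∃ z : K, IsPrimitiveRoot z n) ∧ (r : Cardinal) ≤ Module.rank (ZMod p) K := by
  have hpp : p.Prime := Fact.out
  let x₀ : Multiplicative V := .ofAdd (b ⟨0, hr⟩)
  have hx₀ : σ x₀ ≠ 1 := by
    intro h
    have h1 : x₀ = 1 := hσ (h.trans (map_one σ).symm)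
    exact b.ne_zero _ (Multiplicative.ofAdd.injective h1)
  have hx₀p : σ x₀ ^ p = 1 := by
    rw [← map_pow, ← ofAdd_nsmul, ZModModule.char_nsmul_eq_zero, ofAdd_zero, map_one]
  obtain ⟨c, hc0, hc⟩ := hM.exists_pow_eq_smul_one hx₀p
  have hns : ¬ ∃ d : K, M (σ x₀) = d • 1 := fun h => hx₀ (hM.faithful _ h)
  by_cases hcp : ∃ e, e ^ p = c
  · obtain ⟨e, rfl⟩ := hcp
    have he : e ≠ 0 := by
      rintro rfl
      exact hc0 (zero_pow hpp.ne_zero)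
    have hnil : IsNilpotent (M (σ x₀) - e • 1) := by
      refine ⟨p, ?_⟩
      rw [sub_pow_char_of_commute p (Commute.smul_right (Commute.one_right _) _), hc, smul_pow, one_pow, sub_self]
    obtain ⟨P, hP, hPe⟩ := exists_conj_eq_smul_unipotent he hns hnil
    exact (hM.conj hP).of_unipotent b hσ hn hp hτ hconj heven he (x₀ := x₀) hPe
  · obtain rfl | ⟨k, hk⟩ := hpp.eq_two_or_odd'
    · have hsq : ¬ IsSquare c := fun ⟨e, he⟩ => hcp ⟨e, by rw [he, pow_two]⟩
      obtain ⟨y, hy⟩ := hconj x₀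
      have hτ2 := hM.sq_eq_one_of_not_isSquare hsq hc (k := σ y)
        (by rw [← map_mul, mul_comm, map_mul]) hy
      have hodd : Odd n := Nat.not_even_iff_odd.mp fun h => hp h.two_dvd
      have h1 := orderOf_dvd_of_pow_eq_one hτ2
      rw [hτ, Nat.dvd_prime Nat.prime_two] at h1
      have hn1 : n = 1 := h1.resolve_right fun h => by
        rw [h] at hodd
        exact absurd hodd (by decide)
      subst hn1
      refine ⟨odd_one, ⟨1, IsPrimitiveRoot.one⟩, ?_⟩
      -- A nonsquare in characteristic two rules out finite `K`, so the degree over the prime field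
      -- is infinite.
      refine (Cardinal.natCast_lt_aleph0 (n := r)).le.trans (not_lt.mp fun h => hsq ?_)
      have := Module.rank_lt_aleph0_iff.mp h
      have : Finite K := Module.finite_of_finite (ZMod 2)
      have : Fintype K := Fintype.ofFinite K
      exact FiniteField.isSquare_of_char_two (ringChar.eq K 2) c
    · exfalso
      apply hcp
      have h1 := congrArg Matrix.det hc
      rw [Matrix.det_pow, Matrix.det_smul, Matrix.det_one, mul_one, Fintype.card_fin] at h1
      -- With `p = 2k + 1` and `det ^ p = c ^ 2`, the `p`-th power of this element is `c ^ p / c ^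
      -- (2k) = c`.
      refine ⟨c / (M (σ x₀)).det ^ k, ?_⟩
      rw [div_pow, ← pow_mul, mul_comm k p, pow_mul, h1, ← pow_mul]
      rw [div_eq_iff (pow_ne_zero _ hc0), ← pow_succ', hk]

end IsFaithfulProjective

end ProjectiveGroups

end EssDim

namespace EssDim

/-! ### Algebraic elements of the function field are constants -/

section SeparatesPairs

variable {K A F : Type*} [Field K] [CommRing A] [IsDomain A] [IsIntegrallyClosed A] [Algebra K A]
  [Field F] [Algebra A F] [Algebra K F] [IsScalarTower K A F] [IsFractionRing A F]

/-- An algebraic element lies in `A` by integral closedness. If it were independent of `1`, some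
specialization would make it transcendental. -/
theorem SeparatesPairs.mem_range_of_isAlgebraic (hA : SeparatesPairs K A) {x : F}
    (hx : IsAlgebraic K x) : ∃ c : K, algebraMap K F c = x := by
  obtain ⟨y, rfl⟩ := IsIntegrallyClosed.isIntegral_iff.mp (hx.isIntegral.tower_top (A := A))
  have hy : IsIntegral K y :=
    (isIntegral_algHom_iff (IsScalarTower.toAlgHom K A F) (IsFractionRing.injective A F)).mp
      hx.isIntegral
  by_contra! hc
  have hli : LinearIndependent K ![y, 1] := by
    refine LinearIndependent.pair_iff.mpr fun a b hab => ?_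
    have ha : a = 0 := by
      by_contra ha
      refine hc (-b / a) ?_
      rw [IsScalarTower.algebraMap_apply K A F]
      congr 1
      have h1 : a⁻¹ • (a • y + b • (1 : A)) = 0 := by rw [hab, smul_zero]
      rw [smul_add, inv_smul_smul₀ ha, smul_smul, ← Algebra.algebraMap_eq_smul_one] at h1
      rw [eq_neg_of_add_eq_zero_left h1, ← map_neg]
      congr 1
      ring
    refine ⟨ha, ?_⟩
    rw [ha, zero_smul, zero_add] at hab
    simpa using hab
  obtain ⟨φ, hφ⟩ := hA y 1 hli
  have h1 := transcendental_div_of_linearIndependent hφ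
  rw [map_one, map_one, div_one] at h1
  exact h1 ((hy.map φ).map (IsScalarTower.toAlgHom K (Polynomial K) (RatFunc K))).isAlgebraic

end SeparatesPairs

/-! ### Fields of transcendence degree one -/

section TranscendenceDegree

variable {K F : Type*} [Field K] [Field F] [Algebra K F]

theorem trdeg_adjoin_simple {f : F} (hf : Transcendental K f) : Algebra.trdeg K K⟮f⟯ = 1 := by
  have : Algebra.IsAlgebraic (Polynomial K) (RatFunc K) :=
    IsLocalization.isAlgebraic _ (nonZeroDivisors (Polynomial K))
  have h1 : IsTranscendenceBasis K fun _ : Unit => algebraMap (Polynomial K) (RatFunc K)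
      Polynomial.X :=
    (IsTranscendenceBasis.polynomial Unit K).algebraMap_comp
      (A := RatFunc K)
  have h2 := h1.lift_cardinalMk_eq_trdeg
  have h3 := (RatFunc.algEquivOfTranscendental f hf).lift_trdeg_eq
  have h4 : Algebra.trdeg K (RatFunc K) = 1 := by simpa using h2.symm
  rw [h4, Cardinal.lift_one] at h3
  exact Cardinal.lift_eq_one.mp h3.symm

theorem exists_transcendental_of_trdeg_eq_one (h : Algebra.trdeg K F = 1) :
    ∃ t : F, Transcendental K t ∧ Algebra.IsAlgebraic K⟮t⟯ F := by
  obtain ⟨ι, x, hx⟩ := exists_isTranscendenceBasis' K F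
  have h1 := hx.cardinalMk_eq_trdeg
  rw [h] at h1
  obtain ⟨h2, ⟨i⟩⟩ := Cardinal.eq_one_iff_unique.mp h1
  refine ⟨x i, hx.1.transcendental i, ?_⟩
  have h3 := hx.isAlgebraic_field
  have h4 : Set.range x = {x i} := by
    ext y
    constructor
    · rintro ⟨j, rfl⟩
      rw [Subsingleton.elim j i]
      rfl
    · rintro rfl
      exact ⟨i, rfl⟩
  rwa [h4] at h3

end TranscendenceDegree

/-! ### Faithful subfields of `K(W)` of transcendence degree one -/

section FunctionField

variable {K : Type*} [Field K] {W : Type*} [AddCommGroup W] [Module K W] [FiniteDimensional K W]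

variable (K W) in
theorem separatesPairs_coordRing : SeparatesPairs K (CoordRing K W) :=
  (separatesPairs_mvPolynomial _).of_algEquiv
    (SymmetricAlgebra.equivMvPolynomial (Module.finBasis K (Module.Dual K W)))

instance : IsIntegrallyClosed (CoordRing K W) :=
  IsIntegrallyClosed.of_equiv
    (SymmetricAlgebra.equivMvPolynomial (Module.finBasis K (Module.Dual K W))).symm.toRingEquiv

theorem exists_algebraMap_eq_of_isAlgebraic {x : FunField K W} (hx : IsAlgebraic K x) :
    ∃ c : K, algebraMap K (FunField K W) c = x :=
  (separatesPairs_coordRing K W).mem_range_of_isAlgebraic hx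

variable {G : Type*} [Group G] (ρ : Representation K G W)

omit [FiniteDimensional K W] in
theorem funAction_ι (g : G) (l : Module.Dual K W) :
    funAction ρ g (algebraMap (CoordRing K W) _ (SymmetricAlgebra.ι K _ l)) =
      algebraMap (CoordRing K W) _ (SymmetricAlgebra.ι K _ (ρ.dual g l)) := by
  have h := IsFractionRing.fieldEquivOfAlgEquiv_algebraMap K (FunField K W) (FunField K W)
    (coordAction ρ g) (SymmetricAlgebra.ι K _ l)
  have h' : coordAction ρ g (SymmetricAlgebra.ι K _ l) = SymmetricAlgebra.ι K _ (ρ.dual g l) :=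
    SymmetricAlgebra.lift_ι_apply _ l
  rw [h'] at h
  exact h

theorem funAction_injective (hρ : Function.Injective ρ) : Function.Injective (funAction ρ) := by
  rw [injective_iff_map_eq_one]
  intro g hg
  have h1 : ∀ l : Module.Dual K W, ρ.dual g l = l := by
    intro l
    have h2 := funAction_ι ρ g l
    rw [hg] at h2
    have h3 := IsFractionRing.injective (CoordRing K W) (FunField K W) h2
    -- The trivial square-zero extension is a quotient of the symmetric algebra in which linear
    -- forms remain visible.
    have h5 : ∀ m, SymmetricAlgebra.ι K (Module.Dual K W) m = 0 → m = 0 := by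
      intro m hm
      have := congrArg (SymmetricAlgebra.lift (R := K)
        (TrivSqZeroExt.inrHom K (Module.Dual K W))) hm
      rw [SymmetricAlgebra.lift_ι_apply, map_zero] at this
      exact TrivSqZeroExt.inr_injective this
    refine (sub_eq_zero.mp (h5 _ ?_)).symm
    rw [map_sub, sub_eq_zero]
    exact h3
  have h6 : ρ g⁻¹ = 1 := by
    ext w
    rw [← sub_eq_zero, ← Module.forall_dual_apply_eq_zero_iff K]
    intro l
    have := LinearMap.congr_fun (h1 l) w
    rw [map_sub, sub_eq_zero]
    simpa [Representation.dual_apply, Module.Dual.transpose_apply] using this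
  exact inv_eq_one.mp (hρ (h6.trans (map_one ρ).symm))

variable {ρ}

theorem IsFaithfulSubfield.trdeg_ne_zero [Nontrivial G]
    {E : IntermediateField K (FunField K W)} (hE : IsFaithfulSubfield ρ E) :
    Algebra.trdeg K E ≠ 0 := by
  intro h
  have halg : Algebra.IsAlgebraic K E := trdeg_eq_zero_iff.mp h
  obtain ⟨g, hg⟩ := exists_ne (1 : G)
  refine hg (hE.faithful g fun x hx => ?_)
  have hx' : IsAlgebraic K x :=
    (halg.isAlgebraic ⟨x, hx⟩).algHom E.val
  obtain ⟨c, hc⟩ := exists_algebraMap_eq_of_isAlgebraic hx'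
  rw [← hc, AlgEquiv.commutes]

theorem essDim_eq_one_iff [Nontrivial G] :
    essDim ρ = 1 ↔ ∃ E, IsFaithfulSubfield ρ E ∧ Algebra.trdeg K E = 1 := by
  unfold essDim
  constructor
  · intro h
    have hne : {d : Cardinal | ∃ E : IntermediateField K (FunField K W),
        IsFaithfulSubfield ρ E ∧ d = Algebra.trdeg K E}.Nonempty := by
      -- The infimum of the empty set of cardinals is zero, so the value one guarantees that the
      -- minimum is attained.
      by_contra hne
      rw [Set.not_nonempty_iff_eq_empty] at hne
      rw [hne, Cardinal.sInf_empty] at h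
      exact zero_ne_one h
    obtain ⟨E, hE, h'⟩ := csInf_mem hne
    exact ⟨E, hE, by rw [← h', h]⟩
  · rintro ⟨E, hE, h⟩
    refine le_antisymm (csInf_le' ⟨E, hE, h.symm⟩) (le_csInf ⟨_, E, hE, h.symm⟩ ?_)
    rintro d ⟨E', hE', rfl⟩
    exact Cardinal.one_le_iff_ne_zero.mpr hE'.trdeg_ne_zero

/-- The action on a stable subfield. -/
noncomputable def IsFaithfulSubfield.action {E : IntermediateField K (FunField K W)}
    (hE : IsFaithfulSubfield ρ E) : G →* (E ≃ₐ[K] E) :=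
  MonoidHom.toHomUnits
    { toFun := fun g => ((funAction ρ g).toAlgHom.comp E.val).codRestrict E.toSubalgebra
        fun x => hE.stable g x x.2
      map_one' := AlgHom.ext fun x => Subtype.ext <| by
        change funAction ρ 1 x = x
        rw [map_one]; rfl
      map_mul' := fun g h => AlgHom.ext fun x => Subtype.ext <| by
        change funAction ρ (g * h) x = funAction ρ g (funAction ρ h x)
        rw [map_mul]; rfl }
  |> (AlgEquiv.algHomUnitsEquiv K E).toMonoidHom.comp

theorem IsFaithfulSubfield.coe_action {E : IntermediateField K (FunField K W)}
    (hE : IsFaithfulSubfield ρ E) (g : G) (x : E) :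
    (hE.action g x : FunField K W) = funAction ρ g x := rfl

/-- The embedded copy of `E` in `K(X)` is larger than `K`, so Lüroth makes `E` itself isomorphic to
`K(X)`, and the action on `E` transfers. -/
theorem IsFaithfulSubfield.exists_isFaithfulProjective
    {E : IntermediateField K (FunField K W)} (hE : IsFaithfulSubfield ρ E)
    (h : Algebra.trdeg K E = 1) :
    ∃ M : G → Matrix (Fin 2) (Fin 2) K, IsFaithfulProjective M := by
  obtain ⟨t, ht, halg⟩ := exists_transcendental_of_trdeg_eq_one h
  obtain ⟨i⟩ := exists_algHom_ratFunc (separatesPairs_coordRing K W) E.val ht halg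
  have hne : i.fieldRange ≠ ⊥ := by
    intro hbot
    have h1 : i t ∈ (⊥ : IntermediateField K (RatFunc K)) := hbot ▸ ⟨t, rfl⟩
    obtain ⟨c, hc⟩ := IntermediateField.mem_bot.mp h1
    apply ht
    have : t = algebraMap K E c := i.injective (hc.symm.trans (i.commutes c).symm)
    rw [this]
    exact isAlgebraic_algebraMap c
  let e : E ≃ₐ[K] RatFunc K := (AlgEquiv.ofInjectiveField i).trans
    (RatFunc.Luroth.algEquiv hne).symm
  refine EssDim.exists_isFaithfulProjective
    ((AlgEquiv.autCongr e).toMonoidHom.comp hE.action) ((AlgEquiv.autCongr e).injective.comp ?_)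
  rw [injective_iff_map_eq_one]
  intro g hg
  refine hE.faithful g fun x hx => ?_
  have := hE.coe_action g ⟨x, hx⟩
  rw [hg] at this
  exact this.symm

/-- A faithful affine action of `G` on the line over `K`, given by its linear part `χ` and
translation part `t`, produces a faithful subfield of transcendence degree one. -/
theorem exists_isFaithfulSubfield_of_affine [Finite G] (hρ : Function.Injective ρ) {χ t : G → K}
    (ht : ∀ g h, t (g * h) = χ g * t h + t g) (hχt : ∀ g, χ g = 1 → t g = 0 → g = 1)
    {g₀ : G} (hχ₀ : χ g₀ = 1) (ht₀ : t g₀ ≠ 0) :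
    ∃ E, IsFaithfulSubfield ρ E ∧ Algebra.trdeg K E = 1 := by
  have := Fintype.ofFinite G
  set a := algebraMap K (FunField K W)
  -- An element of trace one exists because distinct automorphisms are linearly independent.
  obtain ⟨u, hu⟩ : ∃ u, ∑ g, funAction ρ g u = 1 := by
    have hli : LinearIndependent (FunField K W) fun g : G =>
        ((funAction ρ g : FunField K W →* FunField K W) : FunField K W → FunField K W) :=
      (linearIndependent_monoidHom (FunField K W) (FunField K W)).comp
        (fun g : G => (funAction ρ g : FunField K W →* FunField K W)) fun g h hgh =>
          funAction_injective ρ hρ (AlgEquiv.ext fun x => DFunLike.congr_fun hgh x)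
    obtain ⟨v, hv⟩ : ∃ v, ∑ g, funAction ρ g v ≠ 0 := by
      by_contra! h0
      have := Fintype.linearIndependent_iff.mp hli (fun _ => 1) (by
        ext v
        simpa using h0 v) 1
      exact one_ne_zero this
    have hinv : ∀ h, funAction ρ h (∑ g, funAction ρ g v) = ∑ g, funAction ρ g v := by
      intro h
      rw [map_sum]
      conv_rhs => rw [← Equiv.sum_comp (Equiv.mulLeft h)]
      exact Finset.sum_congr rfl fun g _ => by
        rw [Equiv.coe_mulLeft, map_mul]; rfl
    refine ⟨v / ∑ g, funAction ρ g v, ?_⟩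
    simp only [map_div₀, hinv]
    rw [← Finset.sum_div, div_self hv]
  -- Averaging the cocycle `t` against `u`, as in the additive Hilbert 90; the coordinate `f`
  -- transforms under `g` by the affine map of `g⁻¹`.
  let f := ∑ g, funAction ρ g u * a (t g)
  have hf : ∀ g, funAction ρ g f = a (χ g⁻¹) * f + a (t g⁻¹) := by
    intro g
    have h1 : funAction ρ g f = ∑ h, funAction ρ (g * h) u * a (t h) := by
      simp only [f, map_sum, map_mul, AlgEquiv.mul_apply]
      exact Finset.sum_congr rfl fun h _ => by rw [(funAction ρ g).commutes]
    have h2 : ∀ h, t h = χ g⁻¹ * t (g * h) + t g⁻¹ := by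
      intro h
      rw [← ht, inv_mul_cancel_left]
    calc funAction ρ g f = ∑ h, funAction ρ (g * h) u * a (χ g⁻¹ * t (g * h) + t g⁻¹) := by
          rw [h1]
          exact Finset.sum_congr rfl fun h _ => by rw [← h2]
      _ = ∑ h, funAction ρ h u * a (χ g⁻¹ * t h + t g⁻¹) :=
          Equiv.sum_comp (Equiv.mulLeft g) fun h => funAction ρ h u * a (χ g⁻¹ * t h + t g⁻¹)
      _ = a (χ g⁻¹) * f + (∑ h, funAction ρ h u) * a (t g⁻¹) := by
          simp only [f, map_add, map_mul, mul_add, Finset.sum_add_distrib, Finset.mul_sum,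
            Finset.sum_mul]
          congr 1
          exact Finset.sum_congr rfl fun h _ => by ring
      _ = _ := by rw [hu, one_mul]
  have htr : Transcendental K f := by
    intro halg
    obtain ⟨c, hc⟩ := exists_algebraMap_eq_of_isAlgebraic halg
    -- A constant `f` would be fixed, whereas this element translates it by `t g₀ ≠ 0`.
    have h1 := hf g₀⁻¹
    rw [← hc, (funAction ρ g₀⁻¹).commutes, inv_inv, hχ₀, map_one, one_mul, left_eq_add] at h1
    exact ht₀ ((map_eq_zero a).mp h1)
  refine ⟨K⟮f⟯, ⟨fun g x hx => ?_, fun g hg => ?_⟩, trdeg_adjoin_simple htr⟩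
  · have h1 : K⟮f⟯.map (funAction ρ g).toAlgHom ≤ K⟮f⟯ := by
      rw [IntermediateField.adjoin_map, Set.image_singleton,
        IntermediateField.adjoin_simple_le_iff]
      change funAction ρ g f ∈ _
      rw [hf]
      exact add_mem (mul_mem (algebraMap_mem _ _) (IntermediateField.mem_adjoin_simple_self K f))
        (algebraMap_mem _ _)
    exact h1 ⟨x, hx, rfl⟩
  · have h1 := hg f (IntermediateField.mem_adjoin_simple_self K f)
    rw [hf] at h1
    have hlin : Polynomial.C (χ g⁻¹ - 1) * Polynomial.X + Polynomial.C (t g⁻¹) = 0 := by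
      apply transcendental_iff.mp htr
      simp only [map_sub, map_add, map_mul, Polynomial.aeval_X, Polynomial.aeval_C, map_one]
      linear_combination h1
    have h2 : χ g⁻¹ = 1 := by
      have := congrArg (fun q => Polynomial.coeff q 1) hlin
      simpa [sub_eq_zero, -map_sub] using this
    have h3 : t g⁻¹ = 0 := by
      have := congrArg (fun q => Polynomial.coeff q 0) hlin
      simpa using this
    exact inv_eq_one.mp (hχt _ h2 h3)

end FunctionField

end EssDim

namespace EssDim

/-! ### Relations between the matrices `sigma` and `tau` -/

section TriangularMatrices

variable {L : Type*} [Field L]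

theorem coe_sigma (v : L) : (sigma v : Matrix (Fin 2) (Fin 2) L) = !![1, v; 0, 1] := rfl

theorem coe_tau (z : Lˣ) (a : L) :
    (tau z a : Matrix (Fin 2) (Fin 2) L) = !![(z : L), a; 0, (z : L)⁻¹] := by
  rw [← Units.val_inv_eq_inv_val]
  rfl

theorem sigma_add (u v : L) : sigma (u + v) = sigma u * sigma v := by
  ext i j
  fin_cases i <;> fin_cases j <;> simp [coe_sigma, add_comm]

theorem sigma_zero : sigma (0 : L) = 1 := by
  ext i j
  fin_cases i <;> fin_cases j <;> simp [coe_sigma]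

theorem sigma_injective : Function.Injective (sigma : L → SL(2, L)) := fun u v h => by
  simpa [sigma] using congrArg (fun g : SL(2, L) => g 0 1) h

theorem tau_mul_sigma (z : Lˣ) (a v : L) : tau z a * sigma v = sigma ((z : L) ^ 2 * v) * tau z a := by
  ext i j
  fin_cases i <;> fin_cases j <;> simp [coe_sigma, coe_tau]
  field_simp
  ring

/-- In this form `f` is a fixed point of the affine map `x ↦ z² x + z a` attached to the matrix,
hence of all its powers. -/
theorem tau_pow (z : Lˣ) (f : L) (k : ℕ) :
    tau z (f * ((z : L)⁻¹ - z)) ^ k = tau (z ^ k) (f * (((z : L) ^ k)⁻¹ - (z : L) ^ k)) := by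
  induction k with
  | zero => ext i j; fin_cases i <;> fin_cases j <;> simp [coe_tau]
  | succ k ih =>
    rw [pow_succ, ih]
    have hz : (z : L) ≠ 0 := z.ne_zero
    ext i j
    fin_cases i <;> fin_cases j <;> simp [coe_tau, pow_succ, mul_comm]
    field_simp
    ring

theorem coe_pow_eq_one {n : ℕ} {z : Lˣ} (hz : IsPrimitiveRoot z n) : (z : L) ^ n = 1 := by
  rw [← Units.val_pow_eq_pow_val, hz.pow_eq_one, Units.val_one]

theorem orderOf_tau {n : ℕ} {z : Lˣ} (hz : IsPrimitiveRoot z n) (f : L) :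
    orderOf (tau z (f * ((z : L)⁻¹ - z))) = n := by
  rw [hz.eq_orderOf]
  refine orderOf_eq_orderOf_iff.mpr fun k => ?_
  rw [tau_pow]
  constructor
  · intro h
    have := congrArg (fun g : SL(2, L) => g 0 0) h
    ext
    simpa [tau] using this
  · intro h
    rw [← Units.val_pow_eq_pow_val, h]
    ext i j
    fin_cases i <;> fin_cases j <;> simp [tau]

/-- Unless `z = z⁻¹`, the matrix `(z, a; 0, z⁻¹)` has a second eigenvector. -/
theorem exists_eq_mul_inv_sub {n : ℕ} {z : Lˣ} (hz : IsPrimitiveRoot z n) {a : L}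
    (ha : n ≤ 2 → a = 0) : ∃ f, a = f * ((z : L)⁻¹ - z) := by
  by_cases h : (z : L)⁻¹ - z = 0
  · refine ⟨0, ?_⟩
    rw [zero_mul]
    apply ha
    refine Nat.le_of_dvd two_pos (hz.dvd_of_pow_eq_one 2 ?_)
    ext
    rw [sub_eq_zero, inv_eq_iff_eq_inv] at h
    push_cast
    rw [pow_two]
    nth_rewrite 1 [h]
    exact inv_mul_cancel₀ z.ne_zero
  · exact ⟨a / ((z : L)⁻¹ - z), (div_mul_cancel₀ a h).symm⟩

theorem tau_pow_mul_sigma {z : Lˣ} {f : L} {m : ℕ} (hm : z ^ (2 * m) = 1) (v : L) :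
    tau z (f * ((z : L)⁻¹ - z)) ^ m * sigma v = sigma v * tau z (f * ((z : L)⁻¹ - z)) ^ m := by
  rw [tau_pow, tau_mul_sigma]
  congr 2
  rw [← Units.val_pow_eq_pow_val, ← pow_mul, mul_comm m 2, hm, Units.val_one, one_mul]

end TriangularMatrices

/-! ### The group `G(n, p ^ r)`: projective constraints and affine action -/

section SemidirectGroup

variable {p : ℕ} [Fact p.Prime] {L : Type*} [Field L] [Algebra (ZMod p) L]
  {n r : ℕ} {ζ : Lˣ} {V : Submodule ((ZMod p)⟮((ζ : L) ^ 2)⟯) L}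
  {α : Module.Basis (Fin r) (ZMod p) V} {a : L}

theorem sigma_mem_semidirectGroup {v : L} (hv : v ∈ V) :
    sigma v ∈ semidirectGroup ζ a fun i => (α i : L) := by
  let S : AddSubgroup V :=
    { carrier := {v | sigma (v : L) ∈ semidirectGroup ζ a fun i => (α i : L)}
      add_mem' := fun {u v} hu hv => by
        simp only [Set.mem_ofPred_eq, Submodule.coe_add, sigma_add]
        exact mul_mem hu hv
      zero_mem' := by
        simp only [Set.mem_ofPred_eq, Submodule.coe_zero, sigma_zero]
        exact one_mem _
      neg_mem' := fun {u} hu => by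
        have h : sigma (-(u : L)) = (sigma (u : L))⁻¹ := by
          rw [eq_inv_iff_mul_eq_one, ← sigma_add, neg_add_cancel, sigma_zero]
        simp only [Set.mem_ofPred_eq, Submodule.coe_neg, h]
        exact inv_mem hu }
  have h1 : Submodule.span (ZMod p) (Set.range α) ≤ AddSubgroup.toZModSubmodule p S := by
    rw [Submodule.span_le]
    rintro _ ⟨i, rfl⟩
    exact Subgroup.subset_closure (Or.inl ⟨i, rfl⟩)
  rw [α.span_eq] at h1
  exact h1 (Submodule.mem_top (x := ⟨v, hv⟩))

variable (ζ a) in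
theorem tau_mem_semidirectGroup (β : Fin r → L) : tau ζ a ∈ semidirectGroup ζ a β :=
  Subgroup.subset_closure (Or.inr rfl)

/-- The translations by elements of `V` as elements of `G(n, p ^ r)`. -/
def sigmaHom (α : Module.Basis (Fin r) (ZMod p) V) (a : L) :
    Multiplicative V →* semidirectGroup ζ a fun i => (α i : L) where
  toFun v := ⟨sigma (v.toAdd : L), sigma_mem_semidirectGroup v.toAdd.2⟩
  map_one' := Subtype.ext (by simp [sigma_zero])
  map_mul' _ _ := Subtype.ext (by simp [sigma_add])

theorem sigmaHom_injective : Function.Injective (sigmaHom α a) := fun _ _ h =>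
  Multiplicative.toAdd.injective (Subtype.ext (sigma_injective (congrArg Subtype.val h)))

theorem odd_and_exists_isPrimitiveRoot_and_le_rank [CharP L p] {K : Type*} [Field K] [CharP K p]
    [Algebra (ZMod p) K] (hn : 0 < n) (hr : 0 < r) (hζ : IsPrimitiveRoot ζ n)
    (ha : n ≤ 2 → a = 0)
    {M : (semidirectGroup ζ a fun i => (α i : L)) → Matrix (Fin 2) (Fin 2) K}
    (hM : IsFaithfulProjective M) :
    Odd n ∧ (∃ z : K, IsPrimitiveRoot z n) ∧ (r : Cardinal) ≤ Module.rank (ZMod p) K := by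
  obtain ⟨f, hf⟩ := exists_eq_mul_inv_sub hζ ha
  -- A primitive `n`-th root of unity in characteristic `p` forces `n` to be prime to `p`.
  have hpn : ¬ p ∣ n := by
    have h1 := (IsPrimitiveRoot.coe_units_iff.mpr hζ)
    have : NeZero n := ⟨hn.ne'⟩
    have := h1.neZero'
    intro h
    exact this.out ((CharP.cast_eq_zero_iff L p n).mpr h)
  refine hM.odd_and_exists_isPrimitiveRoot_and_le_rank hr α (sigmaHom_injective (α := α) (a := a))
    (τ := ⟨tau ζ a, tau_mem_semidirectGroup ζ a _⟩) hn hpn ?_ (fun x => ?_) fun m hm x => ?_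
  · rw [← Subgroup.orderOf_coe, hf]
    exact orderOf_tau hζ f
  · let c : (ZMod p)⟮((ζ : L) ^ 2)⟯ := IntermediateField.AdjoinSimple.gen (ZMod p) ((ζ : L) ^ 2)
    exact ⟨.ofAdd (c • x.toAdd), Subtype.ext (tau_mul_sigma ζ a _)⟩
  · apply Subtype.ext
    change tau ζ a ^ m * sigma _ = sigma _ * tau ζ a ^ m
    subst hf
    exact tau_pow_mul_sigma (by rw [← hm, hζ.pow_eq_one]) _

theorem exists_injective_linearMap_of_finrank_le_rank {k V K : Type*} [Field k] [AddCommGroup V]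
    [Module k V] [FiniteDimensional k V] [AddCommGroup K] [Module k K]
    (h : (Module.finrank k V : Cardinal) ≤ Module.rank k K) :
    ∃ s : V →ₗ[k] K, Function.Injective s := by
  rw [← lift_rank_le_iff_exists_linearMap, ← Module.finrank_eq_rank, Cardinal.lift_natCast]
  simpa using h

/-- A finite dimensional vector space over a finite extension `k` of `F` embeds in an
extension field of `k` whose degree over `F` is large enough. -/
theorem exists_injective_linearMap_of_le_rank {F k V K : Type*} [Field F] [Field k] [Algebra F k]
    [FiniteDimensional F k] [AddCommGroup V] [Module k V] [Module F V] [IsScalarTower F k V]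
    {r : ℕ} (b : Module.Basis (Fin r) F V) [AddCommGroup K] [Module k K] [Module F K]
    [IsScalarTower F k K] (h : (r : Cardinal) ≤ Module.rank F K) :
    ∃ s : V →ₗ[k] K, Function.Injective s := by
  have : FiniteDimensional F V := b.finiteDimensional_of_finite
  have : FiniteDimensional k V := Module.Finite.right F k V
  apply exists_injective_linearMap_of_finrank_le_rank
  -- Otherwise `K` is finite over `F`, and multiplying the strict inequality of `k`-dimensions by
  -- `[k : F]` contradicts `h`.
  by_contra! hlt
  have : FiniteDimensional k K :=
    Module.rank_lt_aleph0_iff.mp (hlt.trans (Cardinal.natCast_lt_aleph0))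
  have : FiniteDimensional F K := Module.Finite.trans k K
  have h1 : Module.finrank F V = r := by rw [Module.finrank_eq_card_basis b, Fintype.card_fin]
  have h2 := Module.finrank_mul_finrank F k V
  have h3 := Module.finrank_mul_finrank F k K
  have h4 : 0 < Module.finrank F k := Module.finrank_pos
  rw [← Module.finrank_eq_rank, Nat.cast_lt] at hlt
  rw [← Module.finrank_eq_rank, Nat.cast_le] at h
  have := Nat.mul_lt_mul_of_pos_left hlt h4
  omega

/-- The minimal polynomial of `ζ²` divides `X ^ n - 1`, which splits in `K`. -/
theorem exists_algHom_adjoin_sq {K : Type*} [Field K] [Algebra (ZMod p) K] (hn : 0 < n)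
    (hζ : IsPrimitiveRoot ζ n) {z : K} (hz : IsPrimitiveRoot z n) :
    Nonempty ((ZMod p)⟮((ζ : L) ^ 2)⟯ →ₐ[ZMod p] K) := by
  apply IntermediateField.nonempty_algHom_adjoin_of_splits
  intro x hx
  rw [Set.mem_singleton_iff.mp hx]
  have hroot : Polynomial.aeval ((ζ : L) ^ 2) (Polynomial.X ^ n - 1 : Polynomial (ZMod p)) = 0 := by
    simp [pow_right_comm _ 2 n, coe_pow_eq_one hζ]
  have hmonic : (Polynomial.X ^ n - 1 : Polynomial (ZMod p)).Monic :=
    Polynomial.monic_X_pow_sub_C 1 hn.ne'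
  refine ⟨⟨_, hmonic, hroot⟩, ?_⟩
  have h1 : (Polynomial.X ^ n - 1 : Polynomial K).Splits := by
    simpa using Polynomial.X_pow_sub_one_splits hz
  refine h1.of_dvd (by simpa using (Polynomial.monic_X_pow_sub_C (1 : K) hn.ne').ne_zero) ?_
  have := Polynomial.map_dvd (algebraMap (ZMod p) K) (minpoly.dvd (ZMod p) _ hroot)
  simpa using this

/-- The entries of the elements of `G(n, p ^ r)`: the last condition says that the affine map
induced by `g` moves the fixed point `f` of the affine map induced by `τ` by an element of `V`. -/
theorem entries_of_mem_semidirectGroup (hζ : IsPrimitiveRoot ζ n) {f : L}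
    (hf : a = f * ((ζ : L)⁻¹ - ζ)) {g : SL(2, L)}
    (hg : g ∈ semidirectGroup ζ a fun i => (α i : L)) :
    g 1 0 = 0 ∧ g 0 0 * g 1 1 = 1 ∧ g 0 0 ^ n = 1 ∧ g 0 0 ^ 2 ∈ (ZMod p)⟮((ζ : L) ^ 2)⟯ ∧
      g 0 0 ^ 2 * f + g 0 0 * g 0 1 - f ∈ V := by
  have hζn : (ζ : L) ^ n = 1 := coe_pow_eq_one hζ
  induction hg using Subgroup.closure_induction with
  | mem g hg =>
    rcases hg with ⟨i, rfl⟩ | rfl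
    · simp [sigma]
    · have h1 : (ζ : L) ^ 2 * f + ζ * (f * ((ζ : L)⁻¹ - ζ)) - f = 0 := by
        field_simp
        ring
      simp [tau, hζn, IntermediateField.mem_adjoin_simple_self, hf, h1]
  | one => simp
  | mul g h _ _ ihg ihh =>
    obtain ⟨g1, g2, g3, g4, g5⟩ := ihg
    obtain ⟨h1, h2, h3, h4, h5⟩ := ihh
    have e00 : (g * h) 0 0 = g 0 0 * h 0 0 := by
      simp [Matrix.mul_apply, Fin.sum_univ_two, h1]
    have e01 : (g * h) 0 1 = g 0 0 * h 0 1 + g 0 1 * h 1 1 := by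
      simp [Matrix.mul_apply, Fin.sum_univ_two]
    have e10 : (g * h) 1 0 = 0 := by simp [Matrix.mul_apply, Fin.sum_univ_two, h1, g1]
    have e11 : (g * h) 1 1 = g 1 1 * h 1 1 := by
      simp [Matrix.mul_apply, Fin.sum_univ_two, g1]
    rw [e00, e01, e10, e11]
    refine ⟨rfl, by linear_combination (h 0 0 * h 1 1) * g2 + h2, by rw [mul_pow, g3, h3, one_mul],
      by rw [mul_pow]; exact mul_mem g4 h4, ?_⟩
    convert! V.add_mem (V.smul_mem ⟨_, g4⟩ h5) g5 using 1
    rw [IntermediateField.smul_def, smul_eq_mul]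
    linear_combination (g 0 0 * g 0 1) * h2
  | inv g _ ihg =>
    obtain ⟨g1, g2, g3, g4, g5⟩ := ihg
    have hi : g⁻¹.1 = !![g 1 1, - g 0 1; - g 1 0, g 0 0] := by
      rw [Matrix.SpecialLinearGroup.coe_inv, Matrix.adjugate_fin_two]
    have e00 : g⁻¹ 0 0 = g 1 1 := by simp [hi]
    have e01 : g⁻¹ 0 1 = - g 0 1 := by simp [hi]
    have e10 : g⁻¹ 1 0 = 0 := by simp [hi, g1]
    have e11 : g⁻¹ 1 1 = g 0 0 := by simp [hi]
    have hg11 : g 1 1 = (g 0 0)⁻¹ := (inv_eq_of_mul_eq_one_right g2).symm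
    have hmem : g 1 1 ^ 2 ∈ (ZMod p)⟮((ζ : L) ^ 2)⟯ := by
      rw [hg11, inv_pow]
      exact inv_mem g4
    rw [e00, e01, e10, e11]
    refine ⟨rfl, by rw [mul_comm]; exact g2, by rw [hg11, inv_pow, g3, inv_one], hmem, ?_⟩
    convert! V.neg_mem (V.smul_mem ⟨_, hmem⟩ g5) using 1
    rw [IntermediateField.smul_def, smul_eq_mul]
    linear_combination (f * (g 0 0 * g 1 1 + 1) + g 0 1 * g 1 1) * g2

/-- When `n` is odd and `K` is large enough, `G(n, p ^ r)` is a finite group of affine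
transformations of the line over `K`. -/
theorem exists_affine {K : Type*} [Field K] [Algebra (ZMod p) K] (hn : 0 < n) (hr : 0 < r)
    (hζ : IsPrimitiveRoot ζ n) (ha : n ≤ 2 → a = 0) (hodd : Odd n)
    {z : K} (hz : IsPrimitiveRoot z n) (hrank : (r : Cardinal) ≤ Module.rank (ZMod p) K) :
    Finite (semidirectGroup ζ a fun i => (α i : L)) ∧
      ∃ (χ t : (semidirectGroup ζ a fun i => (α i : L)) → K) (g₀ : _),
        (∀ g h, t (g * h) = χ g * t h + t g) ∧ (∀ g, χ g = 1 → t g = 0 → g = 1) ∧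
        χ g₀ = 1 ∧ t g₀ ≠ 0 := by
  obtain ⟨f, hf⟩ := exists_eq_mul_inv_sub hζ ha
  let k := (ZMod p)⟮((ζ : L) ^ 2)⟯
  have hζn : (ζ : L) ^ n = 1 := coe_pow_eq_one hζ
  have hfin : FiniteDimensional (ZMod p) k := by
    refine IntermediateField.adjoin.finiteDimensional ⟨Polynomial.X ^ n - 1,
      Polynomial.monic_X_pow_sub_C 1 hn.ne', ?_⟩
    simp [pow_right_comm _ 2 n, hζn]
  obtain ⟨j⟩ := exists_algHom_adjoin_sq (p := p) hn hζ hz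
  let _ : Algebra k K := j.toRingHom.toAlgebra
  have : IsScalarTower (ZMod p) k K := IsScalarTower.of_algebraMap_eq fun x => (j.commutes x).symm
  obtain ⟨s, hs⟩ := exists_injective_linearMap_of_le_rank (k := k) α hrank
  have hent := fun g : semidirectGroup ζ a fun i => (α i : L) =>
    entries_of_mem_semidirectGroup hζ hf g.2
  -- `c` and `w` are the linear and translation parts of `x ↦ g₀₀² x + g₀₀ g₀₁` in the coordinate
  -- centred at `f`; `j` and the `k`-linear `s` carry them to `K`.
  let c : (semidirectGroup ζ a fun i => (α i : L)) → k := fun g => ⟨g.1 0 0 ^ 2, (hent g).2.2.2.1⟩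
  let w : (semidirectGroup ζ a fun i => (α i : L)) → V :=
    fun g => ⟨g.1 0 0 ^ 2 * f + g.1 0 0 * g.1 0 1 - f, (hent g).2.2.2.2⟩
  -- Oddness of `n` enters here: squaring is injective on `n`-th roots of unity, so the affine map
  -- determines the matrix.
  have hsq : ∀ x y : L, x ^ n = 1 → y ^ n = 1 → x ^ 2 = y ^ 2 → x = y := by
    intro x y hx hy hxy
    obtain ⟨m, hm⟩ := hodd
    have e : ∀ x : L, x ^ n = 1 → x = (x ^ 2) ^ (m + 1) := by
      intro x hx
      rw [← pow_mul, show 2 * (m + 1) = n + 1 by omega, pow_succ, hx, one_mul]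
    rw [e x hx, e y hy, hxy]
  have hcw : ∀ g h, c g = c h → w g = w h → g = h := by
    intro g h hc hw
    have h00 := hsq _ _ (hent g).2.2.1 (hent h).2.2.1 (congrArg Subtype.val hc)
    have hne : h.1 0 0 ≠ 0 := left_ne_zero_of_mul_eq_one (hent h).2.1
    have h01 : g.1 0 1 = h.1 0 1 := by
      have : g.1 0 0 ^ 2 * f + g.1 0 0 * g.1 0 1 - f = h.1 0 0 ^ 2 * f + h.1 0 0 * h.1 0 1 - f :=
        congrArg Subtype.val hw
      rw [h00] at this
      apply mul_left_cancel₀ hne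
      linear_combination this
    have h11 : g.1 1 1 = h.1 1 1 := by
      have h1 := (hent g).2.1
      rw [h00] at h1
      exact mul_left_cancel₀ hne (h1.trans (hent h).2.1.symm)
    have h10 : g.1 1 0 = h.1 1 0 := by rw [(hent g).1, (hent h).1]
    apply Subtype.ext
    ext i j
    fin_cases i <;> fin_cases j <;> assumption
  have hmul : ∀ g h, w (g * h) = c g • w h + w g := by
    intro g h
    have e00 : (g * h).1 0 0 = g.1 0 0 * h.1 0 0 := by
      simp [Matrix.mul_apply, Fin.sum_univ_two, (hent h).1]
    have e01 : (g * h).1 0 1 = g.1 0 0 * h.1 0 1 + g.1 0 1 * h.1 1 1 := by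
      simp [Matrix.mul_apply, Fin.sum_univ_two]
    apply Subtype.ext
    change (g * h).1 0 0 ^ 2 * f + (g * h).1 0 0 * (g * h).1 0 1 - f =
      g.1 0 0 ^ 2 * (h.1 0 0 ^ 2 * f + h.1 0 0 * h.1 0 1 - f) +
        (g.1 0 0 ^ 2 * f + g.1 0 0 * g.1 0 1 - f)
    rw [e00, e01]
    linear_combination (g.1 0 0 * g.1 0 1) * (hent h).2.1
  have hc1 : c 1 = 1 := Subtype.ext (by simp [c])
  have hw1 : w 1 = 0 := Subtype.ext (by simp [w])
  have : Finite k := Module.finite_of_finite (ZMod p)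
  have : Module.Finite (ZMod p) V := α.finiteDimensional_of_finite
  have : Finite V := Module.finite_of_finite (ZMod p)
  refine ⟨Finite.of_injective (fun g => (c g, w g)) fun g h hgh =>
    hcw g h (congrArg Prod.fst hgh) (congrArg Prod.snd hgh), fun g => j (c g), fun g => s (w g),
    sigmaHom α a (.ofAdd (α ⟨0, hr⟩)), fun g h => ?_, fun g hχ ht => ?_, ?_, ?_⟩
  · simp only [hmul, map_add, map_smul]
    rfl
  · refine hcw g 1 ?_ ?_
    · rw [hc1]
      exact j.injective (hχ.trans (map_one j).symm)
    · rw [hw1]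
      exact hs (ht.trans (map_zero s).symm)
  · have : c (sigmaHom α a (.ofAdd (α ⟨0, hr⟩))) = 1 := Subtype.ext (by simp [c, sigmaHom, sigma])
    simp only [this, map_one]
  · have : w (sigmaHom α a (.ofAdd (α ⟨0, hr⟩))) = α ⟨0, hr⟩ :=
      Subtype.ext (by simp [w, sigmaHom, sigma])
    simp only [this]
    rw [← map_zero s]
    exact hs.ne (α.ne_zero _)

end SemidirectGroup

end EssDim

theorem theorem1p5
    -- the field `K` of characteristic `p > 0`
    (p : ℕ) [Fact p.Prime] {K : Type*} [Field K] [CharP K p] [Algebra (ZMod p) K]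
    -- the group `G(n, p^r)`, inside `SL₂` of an algebraically closed field of characteristic `p`
    {L : Type*} [Field L] [IsAlgClosed L] [CharP L p] [Algebra (ZMod p) L]
    (n r : ℕ) (hn : 0 < n) (hr : 0 < r)
    (ζ : Lˣ) (hζ : IsPrimitiveRoot ζ n)
    (V : Submodule ((ZMod p)⟮((ζ : L) ^ 2)⟯) L) (α : Module.Basis (Fin r) (ZMod p) V)
    (a : L) (ha : n ≤ 2 → a = 0)
    -- a faithful finite-dimensional representation of that group over `K`
    {W : Type*} [AddCommGroup W] [Module K W] [FiniteDimensional K W]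
    (ρ : Representation K (EssDim.semidirectGroup ζ a (fun i => (α i : L))) W)
    (hρ : Function.Injective ρ) :
    EssDim.essDim ρ = 1 ↔
      Odd n ∧ (∃ z : K, IsPrimitiveRoot z n) ∧ (r : Cardinal) ≤ Module.rank (ZMod p) K := by
  have : Nontrivial (EssDim.semidirectGroup ζ a (fun i => (α i : L))) := by
    refine ⟨EssDim.sigmaHom α a (.ofAdd (α ⟨0, hr⟩)), 1, fun h => α.ne_zero ⟨0, hr⟩ ?_⟩
    exact Multiplicative.ofAdd.injective (EssDim.sigmaHom_injective (h.trans (map_one _).symm))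
  rw [EssDim.essDim_eq_one_iff]
  constructor
  · rintro ⟨E, hE, h⟩
    obtain ⟨M, hM⟩ := hE.exists_isFaithfulProjective h
    exact EssDim.odd_and_exists_isPrimitiveRoot_and_le_rank hn hr hζ ha hM
  · rintro ⟨hodd, ⟨z, hz⟩, hrank⟩
    obtain ⟨hfin, χ, t, g₀, ht, hχt, hχ₀, ht₀⟩ :=
      EssDim.exists_affine (α := α) hn hr hζ ha hodd hz hrank
    exact EssDim.exists_isFaithfulSubfield_of_affine hρ ht hχt hχ₀ ht₀
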